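/- A \emph{map on the torus} is a finite graph $G$ embedded in the torus, without loops and multiple edges and with all valences at least $3$, such that every face (the closure of a component of the complement of $G$) is a closed $2$-cell. (Such maps are described, up to homeomorphism, by rotation systems, i.e. by the cyclic orders of the edges around the vertices.) The map is a \emph{toroidal polyhedral map} (TPM) if the intersection of any two of its faces is empty or connected. Let $G$ be a TPM. An edge $e$ of $G$ is \emph{removable} if deleting $e$, and then coalescing the two edges at every $2$-valent vertex created in this way into one edge, yields a TPM. The edge $e$ is \emph{shrinkable} if contracting $e$ to a vertex, and then replacing the two edges of every two-sided face created in this way by a single edge, yields a TPM. A TPM is \emph{diminimal} if it has no removable and no shrinkable edge. A \emph{planar cycle} of $G$ is a cycle $C$ of $G$ that divides the torus into two regions (connected unions of faces), one of which is simply connected; this one is the planar region enclosed by $C$. $G$ \emph{contains an edge inside a planar cycle} if there are a planar cycle $C$ and an edge $e$ of $G$ such that $e$ lies in the planar region enclosed by $C$ and is disjoint from $C$ (in particular, no end of $e$ lies on $C$). \textbf{Lemma 8.} A map $G$ on the torus that contains an edge inside a planar cycle is not a diminimal TPM. -/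

import Mathlib

open Equiv

/-- `dropPoint π x` takes the point `x` out of its cycle of `π`: it fixes `x`, sends the
predecessor of `x` to the successor of `x`, and agrees with `π` elsewhere. -/
def dropPoint {D : Type*} [DecidableEq D] (π : Perm D) (x : D) : Perm D :=
  swap x (π x) * π

theorem dropPoint_self {D : Type*} [DecidableEq D] (π : Perm D) (x : D) :
    dropPoint π x x = x := by
  simp [dropPoint]

theorem dropPoint_of_fixed {D : Type*} [DecidableEq D] (π : Perm D) (x : D) {y : D}
    (h : π y = y) : dropPoint π x y = y := by
  by_cases hyx : y = x
  · subst hyx; exact dropPoint_self π y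
  · have h2 : y ≠ π x := fun h3 => hyx (π.injective (h.trans h3))
    simp [dropPoint, h, swap_apply_of_ne_of_ne hyx h2]

/-- A combinatorial map (rotation system): the standard description of a graph drawn on a closed
oriented surface so that all complementary components are open discs.
A dart is an oriented edge; `α` reverses a dart, and `σ` sends a dart to the
next one in counterclockwise order among the darts with the same initial vertex. The points of `D`
that `α` moves are the darts of the map; the other points of `D` are unused
(so that deleting darts does not change the ambient type). -/
structure CombMap (D : Type*) where
  /-- rotation around the vertices -/
  σ : Perm D
  /-- reversal of darts -/
  α : Perm D
  α_invol : ∀ x, α (α x) = x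
  σ_unused : ∀ x, α x = x → σ x = x

namespace CombMap

section Basic

variable {D : Type*} (M : CombMap D)

/-- The darts (oriented edges) of the map. -/
def darts : Set D := {x | M.α x ≠ x}

/-- The face permutation: `φ x` is the dart that follows `x` on the boundary of the face on the
left of `x`. -/
def φ : Perm D := M.σ⁻¹ * M.α

/-- The initial vertex of the dart `x`; a vertex is the set of the darts that start at it. -/
def vertex (x : D) : Set D := {y | M.σ.SameCycle x y}

/-- The edge of the dart `x`; an edge is the set of its two darts. -/
def edge (x : D) : Set D := {x, M.α x}

/-- The face on the left of the dart `x`; a face is the set of the darts on its boundary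
that have the face on their left. -/
def face (x : D) : Set D := {y | M.φ.SameCycle x y}

/-- The vertices of the map. -/
def vertices : Set (Set D) := M.vertex '' M.darts

/-- The edges of the map. -/
def edges : Set (Set D) := M.edge '' M.darts

/-- The faces of the map. -/
def faces : Set (Set D) := M.face '' M.darts

/-- The surface that carries the map is connected. -/
def Connected : Prop :=
  ∀ x ∈ M.darts, ∀ y ∈ M.darts,
    Relation.ReflTransGen (fun a b => b = M.σ a ∨ b = M.α a) x y

/-- Maps on the torus: the (oriented closed) surface is non-empty and connected and has Euler
characteristic `0`; the graph has no loops and no multiple edges; every vertex has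
valence at least `3`; every face is a closed 2-cell, that is, its boundary walk does not
repeat a vertex. -/
structure IsToroidalMap : Prop where
  nonempty : M.darts.Nonempty
  connected : M.Connected
  euler : M.vertices.ncard + M.faces.ncard = M.edges.ncard
  loopless : ∀ x ∈ M.darts, M.vertex x ≠ M.vertex (M.α x)
  simple : ∀ x ∈ M.darts, ∀ y ∈ M.darts,
    M.vertex x = M.vertex y → M.vertex (M.α x) = M.vertex (M.α y) → x = y
  valence : ∀ v ∈ M.vertices, 3 ≤ v.ncard
  closedCell : ∀ x ∈ M.darts, ∀ y ∈ M.darts,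
    M.face x = M.face y → M.vertex x = M.vertex y → x = y

/-- Two different (closed) faces `f` and `g` meet properly: their intersection, which consists of
their common vertices and common edges, is empty or connected. A vertex or an edge lies on a face
exactly when they have a dart in common. -/
def MeetProperly (f g : Set D) : Prop :=
  ∀ u ∈ M.vertices, ∀ v ∈ M.vertices,
    (u ∩ f).Nonempty → (u ∩ g).Nonempty → (v ∩ f).Nonempty → (v ∩ g).Nonempty →
      Relation.ReflTransGen
        (fun a b => ∃ x ∈ M.darts, (M.edge x ∩ f).Nonempty ∧ (M.edge x ∩ g).Nonempty ∧
          a = M.vertex x ∧ b = M.vertex (M.α x)) u v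

/-- Toroidal polyhedral maps. -/
structure IsTPM : Prop extends M.IsToroidalMap where
  meetProperly : ∀ f ∈ M.faces, ∀ g ∈ M.faces, f ≠ g → M.MeetProperly f g

/-! Planar cycles -/

/-- A cycle, given by the list of its consecutive darts: a closed path (each dart ends at the vertex
where the next one starts, cyclically) that repeats neither a vertex nor an edge. -/
structure IsCycle (c : List D) : Prop where
  ne_nil : c ≠ []
  darts : ∀ x ∈ c, x ∈ M.darts
  closed : c.map (fun x => M.vertex (M.α x)) = (c.map M.vertex).rotate 1
  vertex_nodup : (c.map M.vertex).Nodup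
  edge_nodup : (c.map M.edge).Nodup

/-- The region cut out by the cycle `c` that contains the face on the left of `x`: the union of the
faces that can be reached from there by crossing edges that are not on `c`.
A union of faces is given by the set of the darts of these faces. -/
def side (c : List D) (x : D) : Set D :=
  {y | Relation.ReflTransGen
    (fun a b => b = M.φ a ∨ (b = M.α a ∧ M.edge a ∉ c.map M.edge)) x y}

/-- The regions into which the cycle `c` divides the surface. -/
def regions (c : List D) : Set (Set D) := M.side c '' M.darts

/-- `p` is an edge path from the vertex `u` to the vertex `v` that uses only edges of the closed
region `R`, that is, of edges with a face of `R` on at least one side. -/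
def IsWalkIn (R : Set D) : Set D → Set D → List D → Prop
  | u, v, [] => u = v
  | u, v, x :: p =>
      (x ∈ R ∨ M.α x ∈ R) ∧ M.vertex x = u ∧ IsWalkIn R (M.vertex (M.α x)) v p

/-- The closed walk once around the face on the left of `x`, starting with `x`. -/
noncomputable def faceWalk (x : D) : List D := List.iterate M.φ x (M.face x).ncard

/-- Elementary homotopies of edge paths: `q` is obtained from `p` by leaving out an edge
traversed forth and back at once, or a walk once around a face of the region `R`. -/
inductive ElementaryMove (R : Set D) : List D → List D → Prop
  | spur (p q : List D) (x : D) : ElementaryMove R (p ++ [x, M.α x] ++ q) (p ++ q)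
  | face (p q : List D) (x : D) (hx : x ∈ R) : ElementaryMove R (p ++ M.faceWalk x ++ q) (p ++ q)

/-- Homotopy of closed edge paths of the region `R` based at the vertex `u`. -/
def Homotopic (R : Set D) (u : Set D) : List D → List D → Prop :=
  Relation.EqvGen
    (fun p q => M.IsWalkIn R u u p ∧ M.IsWalkIn R u u q ∧ M.ElementaryMove R p q)

/-- The closed region `R` (a union of closed faces) is simply connected: any two of its vertices are
joined by an edge path in it, and each closed edge path in it is homotopic in it to the constant
path. -/
structure SimplyConnected (R : Set D) : Prop where
  joined : ∀ x ∈ R, ∀ y ∈ R, ∃ p, M.IsWalkIn R (M.vertex x) (M.vertex y) p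
  trivial : ∀ x ∈ R, ∀ p, M.IsWalkIn R (M.vertex x) (M.vertex x) p →
    M.Homotopic R (M.vertex x) p []

/-- The cycle `c` divides the surface into two regions, and `R` is one of them and
is simply connected: `c` is a planar cycle that encloses the planar region `R`. -/
structure IsPlanarCycle (c : List D) (R : Set D) : Prop where
  isCycle : M.IsCycle c
  two_regions : (M.regions c).ncard = 2
  mem_regions : R ∈ M.regions c
  simplyConnected : M.SimplyConnected R

/-- The map contains an edge inside a planar cycle: an edge (of the dart `x`) that lies in the planar
region enclosed by the cycle and is disjoint from the cycle (no end is on the cycle). -/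
def HasEdgeInsideCycle : Prop :=
  ∃ (c : List D) (R : Set D), M.IsPlanarCycle c R ∧
    ∃ x ∈ M.darts, x ∈ R ∧ ∀ y ∈ c, M.vertex y ≠ M.vertex x ∧ M.vertex y ≠ M.vertex (M.α x)

end Basic

/-! Removing and shrinking of edges -/

section Operations

variable {D : Type*} [DecidableEq D] (M : CombMap D)

/-- Delete the edge of the dart `x`: its two darts are taken out of the rotations at the two ends. -/
def deleteEdge (x : D) : CombMap D where
  σ := dropPoint (dropPoint M.σ x) (M.α x)
  α := M.α * swap x (M.α x)
  α_invol := by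
    intro y
    by_cases h1 : y = x
    · subst h1; simp [M.α_invol y]
    by_cases h2 : y = M.α x
    · subst h2; simp
    have h3 : M.α y ≠ x := fun h => h2 (by rw [← h, M.α_invol])
    have h4 : M.α y ≠ M.α x := fun h => h1 (M.α.injective h)
    simp [swap_apply_of_ne_of_ne h1 h2, swap_apply_of_ne_of_ne h3 h4, M.α_invol]
  σ_unused := by
    intro y hy
    by_cases h1 : y = x
    · subst h1; exact dropPoint_of_fixed _ _ (dropPoint_self _ _)
    by_cases h2 : y = M.α x
    · subst h2; exact dropPoint_self _ _
    simp only [Perm.mul_apply, swap_apply_of_ne_of_ne h1 h2] at hy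
    exact dropPoint_of_fixed _ _ (dropPoint_of_fixed _ _ (M.σ_unused y hy))

/-- Contract the edge of the dart `x` (which is not a loop): the rotations
`(x, a₁, …, aₖ)` and `(α x, b₁, …, bₗ)` at its two ends
become the rotation `(a₁, …, aₖ, b₁, …, bₗ)` at one vertex. -/
def contractEdge (x : D) : CombMap D where
  σ := dropPoint (dropPoint (M.σ * swap x (M.α x)) x) (M.α x)
  α := (M.deleteEdge x).α
  α_invol := (M.deleteEdge x).α_invol
  σ_unused := by
    intro y hy
    by_cases h1 : y = x
    · subst h1; exact dropPoint_of_fixed _ _ (dropPoint_self _ _)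
    by_cases h2 : y = M.α x
    · subst h2; exact dropPoint_self _ _
    simp only [deleteEdge, Perm.mul_apply, swap_apply_of_ne_of_ne h1 h2] at hy
    refine dropPoint_of_fixed _ _ (dropPoint_of_fixed _ _ ?_)
    simp only [Perm.mul_apply, swap_apply_of_ne_of_ne h1 h2]
    exact M.σ_unused y hy

/-- The reversal of darts after the darts `x` and `y` are taken out and the
darts `α x` and `α y` are made the two darts of one edge. -/
theorem fuse_aux (x y : D) (hx : x ∈ M.darts) (hy : y ∈ M.darts) (hxy : x ≠ y) (z : D) :
    dropPoint (dropPoint (M.α * swap x y) x) y z =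
      if z = x ∨ z = y then z else if z = M.α x then M.α y else if z = M.α y then M.α x
      else M.α z := by
  have hx' : M.α x ≠ x := hx
  have hy' : M.α y ≠ y := hy
  have ix := M.α_invol x
  have iy := M.α_invol y
  have iz := M.α_invol z
  simp only [dropPoint, Perm.mul_apply, swap_apply_def]
  grind

/-- Replace the edges of two darts `x ≠ y` by a single edge: the darts `x` and `y` are taken out, and
the darts `α x` and `α y` become the two darts of one edge. If `x` and `y` are the two
darts that start at a 2-valent vertex, this coalesces the two edges at that vertex into one edge; if
`x` and `y` bound a two-sided face, this replaces the two edges of that face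
with one edge. -/
def fuse (x y : D) (hx : x ∈ M.darts) (hy : y ∈ M.darts) (hxy : x ≠ y) : CombMap D where
  σ := dropPoint (dropPoint M.σ x) y
  α := dropPoint (dropPoint (M.α * swap x y) x) y
  α_invol := by
    intro z
    have hx' : M.α x ≠ x := hx
    have hy' : M.α y ≠ y := hy
    have ix := M.α_invol x
    have iy := M.α_invol y
    have iz := M.α_invol z
    rw [M.fuse_aux x y hx hy hxy z, M.fuse_aux x y hx hy hxy]
    grind
  σ_unused := by
    intro z hz
    rw [M.fuse_aux x y hx hy hxy z] at hz
    by_cases h1 : z = x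
    · subst h1; exact dropPoint_of_fixed _ _ (dropPoint_self _ _)
    by_cases h2 : z = y
    · subst h2; exact dropPoint_self _ _
    refine dropPoint_of_fixed _ _ (dropPoint_of_fixed _ _ (M.σ_unused z ?_))
    have ix := M.α_invol x
    have iy := M.α_invol y
    have iz := M.α_invol z
    grind

/-- `M'` is obtained from `M` by coalescing the two edges at a 2-valent vertex. -/
def CoalesceStep (M M' : CombMap D) : Prop :=
  ∃ (x y : D) (hx : x ∈ M.darts) (hy : y ∈ M.darts) (hxy : x ≠ y),
    M.σ x = y ∧ M.σ y = x ∧ M.α x ≠ y ∧ M' = M.fuse x y hx hy hxy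

/-- `M'` is obtained from `M` by replacing the two edges of a two-sided face with one edge. -/
def DigonStep (M M' : CombMap D) : Prop :=
  ∃ (x y : D) (hx : x ∈ M.darts) (hy : y ∈ M.darts) (hxy : x ≠ y),
    M.φ x = y ∧ M.φ y = x ∧ M.α x ≠ y ∧ M' = M.fuse x y hx hy hxy

/-- The edge of `x` is removable: deleting it, and coalescing the
edges at the 2-valent vertices created by that, gives a toroidal polyhedral map. -/
def Removable (x : D) : Prop :=
  ∃ M' : CombMap D, Relation.ReflTransGen CoalesceStep (M.deleteEdge x) M' ∧ M'.IsTPM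

/-- The edge of `x` is shrinkable: contracting it, and replacing the two
edges of every two-sided face created by that with one edge, gives a toroidal polyhedral map. -/
def Shrinkable (x : D) : Prop :=
  ∃ M' : CombMap D, Relation.ReflTransGen DigonStep (M.contractEdge x) M' ∧ M'.IsTPM

/-- Diminimal toroidal polyhedral maps. -/
structure IsDiminimalTPM : Prop where
  isTPM : M.IsTPM
  not_removable : ∀ x ∈ M.darts, ¬ M.Removable x
  not_shrinkable : ∀ x ∈ M.darts, ¬ M.Shrinkable x

end Operations

end CombMap

/-!
The edge `e = uv` inside the cycle is itself removable or shrinkable. Let `f` and `g` be the two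
faces at `e`.

If `e` is not removable, then some third face `h`, which contains neither `u` nor `v`, meets `f`
in a vertex `a` and `g` in a vertex `b` (`Blocked`, `Polyhedral.removable`): otherwise merging `f`
and `g` creates no improper intersection, and a possible third face at a 3-valent end of `e` does
no harm because this end is coalesced. Two-sided faces cannot arise, because the Euler
characteristic would be wrong (`PrePolyhedral.polyhedral`). Dually, if `e` is not shrinkable, then
some vertex `w` on neither `f` nor `g` lies on a face `k` at `u` and on a face `l` at `v`
(`Polyhedral.shrinkable`). To deduce this from the first statement, toroidal polyhedral maps are
described by the self-dual conditions `Polyhedral` on the orbits of darts, and the dual of a map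
is taken on the same darts.

Suppose that both happen. No end of `e` is on the cycle, so all faces at `u` and `v`, in
particular `k` and `l`, belong to the planar region. The closed walk along `k` from `u` to `w`,
along `l` from `w` to `v` and along `e` back to `u` is therefore null-homotopic, hence the
boundary of a combination of faces (`Homotopic.homologous`). But the closed curve through `f`,
`a`, `h`, `b`, `g` crosses it exactly once, at `e`: the multiplicities of the faces in that
combination agree for `f` and `h` (around `a`), and for `h` and `g` (around `b`), while those of
`f` and `g` differ by `1` because of `e` (`not_blocked_of_region`).
-/

/-! ### Orbits of permutations and numbers of classes -/

theorem sameCycle_induction {D : Type*} [Finite D] {π : Perm D} {E : D → Prop} {y z : D}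
    (h : π.SameCycle y z) (h0 : E y) (hs : ∀ w, π.SameCycle y w → E w → E (π w)) : E z := by
  obtain ⟨n, rfl⟩ := h.exists_nat_pow_eq
  clear h
  induction n with
  | zero => simpa using h0
  | succ n ih =>
    rw [pow_succ', Perm.mul_apply]
    exact hs _ ⟨n, by simp⟩ ih

theorem sameCycle_apply_self {D : Type*} (π : Perm D) (x : D) : π.SameCycle x (π x) :=
  Perm.sameCycle_apply_right.2 .rfl

theorem dropPoint_apply {D : Type*} [DecidableEq D] (π : Perm D) (x y : D) :
    dropPoint π x y = if y = x then x else if π y = x then π x else π y := by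
  by_cases h : y = x
  · subst h; simp [dropPoint]
  · have : π y ≠ π x := fun h' => h (π.injective h')
    by_cases h2 : π y = x <;> simp [dropPoint, swap_apply_def, h, h2, this]

theorem dropPoint_dropPoint_apply {D : Type*} [DecidableEq D] (π : Perm D) (x y z : D) :
    dropPoint (dropPoint π x) y z =
      if z = x ∨ z = y then z else if π z = x then (if π x = y then π y else π x)
      else if π z = y then (if π y = x then π x else π y) else π z := by
  have h := dropPoint_apply π x
  rw [dropPoint_apply, h, h]
  clear h
  have hi : ∀ a b, π a = π b → a = b := fun a b h => π.injective h
  split_ifs <;> grind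

theorem sameCycle_dropPoint {D : Type*} [Finite D] [DecidableEq D] (π : Perm D) {x y z : D}
    (hy : y ≠ x) (hz : z ≠ x) : (dropPoint π x).SameCycle y z ↔ π.SameCycle y z := by
  constructor
  · intro h
    refine sameCycle_induction h .rfl fun w _ hw => ?_
    rw [dropPoint_apply]
    split_ifs with h1 h2
    · rwa [← h1]
    · rw [← h2]; simpa using hw
    · simpa using hw
  · intro h
    -- the point `x` on the way from `y` to `z` stands for its successor
    have key : (dropPoint π x).SameCycle y (if z = x then π x else z) := by
      refine sameCycle_induction
        (E := fun w => (dropPoint π x).SameCycle y (if w = x then π x else w))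
        h ?_ fun w _ hw => ?_
      · simp [hy, Perm.SameCycle.rfl]
      · by_cases h1 : w = x
        · subst h1
          simp only [if_true] at hw
          split_ifs <;> simpa using hw
        · have h2 : dropPoint π x w = if π w = x then π x else π w := by
            rw [dropPoint_apply, if_neg h1]
          rw [← h2]
          simpa [h1] using hw
    simpa [hz] using key

/-- Composition with the transposition of two points of different orbits merges the orbits. -/
theorem sameCycle_mul_swap {D : Type*} [Finite D] [DecidableEq D] (π : Perm D) {a b : D}
    (hab : ¬ π.SameCycle a b) (y z : D) : (π * swap a b).SameCycle y z ↔
      π.SameCycle y z ∨ ((π.SameCycle a y ∨ π.SameCycle b y) ∧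
        (π.SameCycle a z ∨ π.SameCycle b z)) := by
  have hA : ∀ w, w ≠ a → w ≠ b → (π * swap a b) w = π w := fun w h1 h2 => by
    simp [swap_apply_of_ne_of_ne h1 h2]
  have hb : (π * swap a b) b = π a := by simp
  have ha : (π * swap a b) a = π b := by simp
  set ρ := π * swap a b
  constructor
  · intro h
    refine sameCycle_induction (E := fun w => π.SameCycle y w ∨
      ((π.SameCycle a y ∨ π.SameCycle b y) ∧ (π.SameCycle a w ∨ π.SameCycle b w)))
      h (Or.inl .rfl) fun w _ hw => ?_
    by_cases h1 : w = a
    · subst h1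
      rw [ha]
      simp only [Perm.sameCycle_apply_right]
      rcases hw with hw | ⟨hw, -⟩
      · exact Or.inr ⟨Or.inl hw.symm, Or.inr .rfl⟩
      · exact Or.inr ⟨hw, Or.inr .rfl⟩
    by_cases h2 : w = b
    · subst h2
      rw [hb]
      simp only [Perm.sameCycle_apply_right]
      rcases hw with hw | ⟨hw, -⟩
      · exact Or.inr ⟨Or.inr hw.symm, Or.inl .rfl⟩
      · exact Or.inr ⟨hw, Or.inl .rfl⟩
    rw [hA w h1 h2]
    simpa only [Perm.sameCycle_apply_right] using hw
  · have h1 : ∀ w, π.SameCycle a w → ρ.SameCycle b w := fun w hw => by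
      have h0 : ρ.SameCycle b (π a) := hb ▸ sameCycle_apply_self ρ b
      refine sameCycle_induction (Perm.sameCycle_apply_left.2 hw) h0 fun v hv hbv => ?_
      by_cases hva : v = a
      · rwa [hva]
      have hvb : v ≠ b := fun h => hab (by rw [← h]; simpa using hv)
      rw [← hA v hva hvb]
      simpa using hbv
    have h2 : ∀ w, π.SameCycle b w → ρ.SameCycle a w := fun w hw => by
      have h0 : ρ.SameCycle a (π b) := ha ▸ sameCycle_apply_self ρ a
      refine sameCycle_induction (Perm.sameCycle_apply_left.2 hw) h0 fun v hv hbv => ?_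
      by_cases hvb : v = b
      · rwa [hvb]
      have hva : v ≠ a := fun h =>
        hab (by rw [← h]; exact (by simpa using hv : π.SameCycle b v).symm)
      rw [← hA v hva hvb]
      simpa using hbv
    have h3 : ρ.SameCycle b a := h1 a .rfl
    have h4 : ∀ w, π.SameCycle a w ∨ π.SameCycle b w → ρ.SameCycle a w := by
      rintro w (hw | hw)
      · exact h3.symm.trans (h1 w hw)
      · exact h2 w hw
    rintro (h | ⟨hy, hz⟩)
    · by_cases hy : π.SameCycle a y ∨ π.SameCycle b y
      · refine (h4 y hy).symm.trans (h4 z ?_)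
        exact hy.imp (fun h' => h'.trans h) fun h' => h'.trans h
      · refine sameCycle_induction h .rfl fun w hw hyw => ?_
        have hwa : w ≠ a := fun h' => hy (Or.inl (by rw [← h']; exact hw.symm))
        have hwb : w ≠ b := fun h' => hy (Or.inr (by rw [← h']; exact hw.symm))
        rw [← hA w hwa hwb]
        simpa using hyw
    · exact (h4 y hy).symm.trans (h4 z hz)

theorem ncard_image_congr {D E F : Type*} {A : Set D} {c : D → E} {c' : D → F}
    (h : ∀ y ∈ A, ∀ z ∈ A, (c' y = c' z ↔ c y = c z)) : (c' '' A).ncard = (c '' A).ncard := by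
  refine Set.ncard_congr (fun e he => c he.choose) ?_ ?_ ?_
  · intro e he
    exact ⟨_, he.choose_spec.1, rfl⟩
  · intro e e' he he' hee
    have := (h _ he.choose_spec.1 _ he'.choose_spec.1).2 hee
    rw [← he.choose_spec.2, this, he'.choose_spec.2]
  · rintro _ ⟨y, hy, rfl⟩
    have he : c' y ∈ c' '' A := ⟨y, hy, rfl⟩
    exact ⟨c' y, he, (h _ he.choose_spec.1 _ hy).1 he.choose_spec.2⟩

/-- The number of classes does not change if the classes are restricted to a set that meets
all of them. -/
theorem ncard_classes_restrict {D E F : Type*} {A A' : Set D} {c : D → E} {c' : D → F}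
    (hA : A' ⊆ A) (hm : ∀ w ∈ A, ∃ w' ∈ A', c w' = c w)
    (h : ∀ y ∈ A', ∀ z ∈ A', (c' y = c' z ↔ c y = c z)) : (c' '' A').ncard = (c '' A).ncard := by
  rw [ncard_image_congr h]
  congr 1
  ext e
  constructor
  · rintro ⟨w, hw, rfl⟩; exact ⟨w, hA hw, rfl⟩
  · rintro ⟨w, hw, rfl⟩; exact hm w hw

/-- The number of classes drops by one if the classes are restricted to a set that misses exactly
the class of `a`. -/
theorem ncard_classes_remove {D E F : Type*} [Finite D] {A A' : Set D} {c : D → E} {c' : D → F}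
    {a : D} (hA : A' ⊆ A) (ha : a ∈ A) (hm : ∀ w ∈ A, c w = c a ∨ ∃ w' ∈ A', c w' = c w)
    (hn : ∀ w ∈ A', c w ≠ c a)
    (h : ∀ y ∈ A', ∀ z ∈ A', (c' y = c' z ↔ c y = c z)) :
    (c' '' A').ncard + 1 = (c '' A).ncard := by
  rw [ncard_image_congr h, ← Set.ncard_insert_of_notMem (a := c a)]
  · congr 1
    ext e
    constructor
    · rintro (rfl | ⟨w, hw, rfl⟩)
      · exact ⟨a, ha, rfl⟩
      · exact ⟨w, hA hw, rfl⟩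
    · rintro ⟨w, hw, rfl⟩
      rcases hm w hw with h1 | ⟨w', h1, h2⟩
      · exact Or.inl h1
      · exact Or.inr ⟨w', h1, h2⟩
  · rintro ⟨w, hw, hwa⟩; exact hn w hw hwa

/-- The number of classes drops by one if, besides the restriction, the classes of `a` and `b` are
merged. -/
theorem ncard_classes_merge {D E F : Type*} [Finite D] {A A' : Set D} {c : D → E} {c' : D → F}
    {a b : D} (hA : A' ⊆ A) (ha : a ∈ A) (hb : b ∈ A) (hab : c a ≠ c b)
    (hm : ∀ w ∈ A, ∃ w' ∈ A', c w' = c w)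
    (h : ∀ y ∈ A', ∀ z ∈ A', (c' y = c' z ↔ c y = c z ∨
      ((c y = c a ∨ c y = c b) ∧ (c z = c a ∨ c z = c b)))) :
    (c' '' A').ncard + 1 = (c '' A).ncard := by
  classical
  let d : D → E := fun w => if c w = c b then c a else c w
  have hd : ∀ y ∈ A', ∀ z ∈ A', (c' y = c' z ↔ d y = d z) := by
    intro y hy z hz
    rw [h y hy z hz]
    simp only [d]
    split_ifs <;> grind
  rw [ncard_image_congr hd, ← Set.ncard_insert_of_notMem (a := c b)]
  · congr 1
    ext e
    constructor
    · rintro (rfl | ⟨w, hw, rfl⟩)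
      · exact ⟨b, hb, rfl⟩
      · simp only [d]
        split_ifs with h1
        · exact ⟨a, ha, rfl⟩
        · exact ⟨w, hA hw, rfl⟩
    · rintro ⟨w, hw, rfl⟩
      by_cases h1 : c w = c b
      · exact Or.inl h1
      · obtain ⟨w', h2, h3⟩ := hm w hw
        exact Or.inr ⟨w', h2, by simp [d, h3, h1]⟩
  · rintro ⟨w, hw, hwa⟩
    simp only [d] at hwa
    split_ifs at hwa with h1
    · exact hab hwa
    · exact h1 hwa

namespace CombMap

/-! ### Vertices and faces as orbits -/

section Orbits

variable {D : Type*} (M : CombMap D)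

theorem φ_apply (x : D) : M.φ x = M.σ⁻¹ (M.α x) := rfl

theorem σ_φ (x : D) : M.σ (M.φ x) = M.α x := by simp [φ_apply]

theorem φ_α (x : D) : M.φ (M.α x) = M.σ⁻¹ x := by rw [φ_apply, M.α_invol]

theorem φ_α_σ (x : D) : M.φ (M.α (M.σ x)) = x := by simp [φ_α]

theorem α_inv : M.α⁻¹ = M.α := by
  ext x; rw [Perm.inv_eq_iff_eq, M.α_invol]

theorem vertex_eq_iff {x y : D} : M.vertex x = M.vertex y ↔ M.σ.SameCycle x y := by
  constructor
  · intro h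
    have : y ∈ M.vertex x := by rw [h]; exact Perm.SameCycle.rfl
    exact this
  · intro h
    ext z
    exact ⟨fun h' => h.symm.trans h', fun h' => h.trans h'⟩

theorem face_eq_iff {x y : D} : M.face x = M.face y ↔ M.φ.SameCycle x y := by
  constructor
  · intro h
    have : y ∈ M.face x := by rw [h]; exact Perm.SameCycle.rfl
    exact this
  · intro h
    ext z
    exact ⟨fun h' => h.symm.trans h', fun h' => h.trans h'⟩

theorem edge_eq_iff {x y : D} : M.edge x = M.edge y ↔ y = x ∨ y = M.α x := by
  simp only [edge]
  constructor
  · intro h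
    have : y ∈ ({x, M.α x} : Set D) := by rw [h]; simp
    simpa using this
  · rintro (rfl | rfl)
    · rfl
    · rw [M.α_invol, Set.pair_comm]

theorem α_mem_darts {x : D} : M.α x ∈ M.darts ↔ x ∈ M.darts := by
  simp only [darts, Set.mem_ofPred_eq, M.α_invol, ne_comm]

theorem σ_mem_darts {x : D} (hx : x ∈ M.darts) : M.σ x ∈ M.darts := fun h =>
  hx (by
    have h1 := M.σ.injective (M.σ_unused _ h)
    rwa [h1] at h)

theorem σ_eq_self_of_notMem {x : D} (hx : x ∉ M.darts) : M.σ x = x :=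
  M.σ_unused x (not_not.1 hx)

theorem φ_eq_self_of_notMem {x : D} (hx : x ∉ M.darts) : M.φ x = x := by
  rw [φ_apply, not_not.1 hx, Perm.inv_eq_iff_eq, M.σ_eq_self_of_notMem hx]

theorem mem_darts_of_sameCycle_σ {x y : D} (h : M.σ.SameCycle x y) (hx : x ∈ M.darts) :
    y ∈ M.darts := by
  by_contra hy
  exact hy (h.eq_of_right (M.σ_eq_self_of_notMem hy) ▸ hx)

theorem mem_darts_of_sameCycle_φ {x y : D} (h : M.φ.SameCycle x y) (hx : x ∈ M.darts) :
    y ∈ M.darts := by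
  by_contra hy
  exact hy (h.eq_of_right (M.φ_eq_self_of_notMem hy) ▸ hx)

theorem sameCycle_σ_φ (x : D) : M.σ.SameCycle (M.φ x) (M.α x) := by
  rw [← σ_φ]; exact sameCycle_apply_self _ _

theorem sameCycle_φ_σ_inv (x : D) : M.φ.SameCycle (M.α x) (M.σ⁻¹ x) := by
  rw [← φ_α]; exact sameCycle_apply_self _ _

theorem sameCycle_σ_inv (x : D) : M.σ.SameCycle x (M.σ⁻¹ x) := by
  simpa using (sameCycle_apply_self M.σ (M.σ⁻¹ x)).symm

theorem sameCycle_φ_α_σ (x : D) : M.φ.SameCycle (M.α (M.σ x)) x := by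
  simpa [φ_α_σ] using sameCycle_apply_self M.φ (M.α (M.σ x))

end Orbits

/-! ### Polyhedral maps in self-dual form -/

section Polyhedral

variable {D : Type*}

/-- The conditions of a toroidal polyhedral map, in terms of orbits of darts, without the lower bound
on the sizes of the faces. In `cell` a dart is read as an incidence of its initial vertex with the
face on its left. In `meet`, two vertices (those of `p`, `q` and of `r`, `s`) lie on two faces
(those of `p`, `r` and of `q`, `s`); then the vertices or the faces agree, or there is an edge
joining the vertices and separating the faces. -/
structure PrePolyhedral (M : CombMap D) : Prop where
  nonempty : M.darts.Nonempty
  connected : M.Connected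
  euler : M.vertices.ncard + M.faces.ncard = M.edges.ncard
  cell : ∀ x y, M.φ.SameCycle x y → M.σ.SameCycle x y → x = y
  deg : ∀ x ∈ M.darts, M.σ (M.σ x) ≠ x
  meet : ∀ p q s r, M.σ.SameCycle p q → M.φ.SameCycle q s → M.σ.SameCycle s r →
    M.φ.SameCycle r p → p = r ∨ p = q ∨ M.α p = s ∨ M.α q = r

/-- Toroidal polyhedral maps, described by conditions that are invariant under duality. -/
structure Polyhedral (M : CombMap D) : Prop extends PrePolyhedral M where
  face_deg : ∀ x ∈ M.darts, M.φ (M.φ x) ≠ x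

namespace PrePolyhedral

variable {M : CombMap D}

theorem σ_ne (h : PrePolyhedral M) {x : D} (hx : x ∈ M.darts) : M.σ x ≠ x :=
  fun h' => h.deg x hx (by rw [h', h'])

theorem not_sameCycle_φ_α (h : PrePolyhedral M) {x : D} (hx : x ∈ M.darts) :
    ¬ M.φ.SameCycle x (M.α x) := fun h' => by
  have := h.cell _ _ (h'.trans (M.sameCycle_φ_σ_inv x)) (M.sameCycle_σ_inv x)
  exact h.σ_ne hx (by nth_rw 1 [this]; simp)

theorem φ_ne (h : PrePolyhedral M) {x : D} (hx : x ∈ M.darts) : M.φ x ≠ x := fun h' => by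
  -- the edge of a one-sided face is a loop whose two darts are neighbours at their vertex
  have h1 : M.σ x = M.α x := by rw [← M.σ_φ, h']
  have h2 := h.cell (M.α x) (M.σ⁻¹ x) (M.sameCycle_φ_σ_inv x)
    (by rw [← h1]; simpa using M.sameCycle_σ_inv x)
  exact h.deg x hx (by rw [h1, h2]; simp)

theorem not_sameCycle_σ_α (h : PrePolyhedral M) {x : D} (hx : x ∈ M.darts) :
    ¬ M.σ.SameCycle x (M.α x) := fun h' =>
  h.φ_ne hx (h.cell _ _ (sameCycle_apply_self M.φ x) (h'.trans (M.sameCycle_σ_φ x).symm)).symm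

/-- A two-sided face would force the whole map to consist of two vertices joined by three edges,
which is a map on the sphere. -/
theorem polyhedral [Finite D] (h : PrePolyhedral M) : Polyhedral M where
  __ := h
  face_deg := by
    intro p hp hpp
    set p' := M.φ p with hp'
    have e1 : M.σ p' = M.α p := M.σ_φ p
    have e2 : M.σ p = M.α p' := by rw [← hpp, M.σ_φ]
    have hp'd : p' ∈ M.darts := M.mem_darts_of_sameCycle_φ (sameCycle_apply_self M.φ p) hp
    have hne : p' ≠ p := h.φ_ne hp
    -- the outer sides of the two edges: their faces meet in both vertices
    have hm := h.meet (M.σ⁻¹ p) (M.α p') (M.σ⁻¹ p') (M.α p)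
      (by rw [← e2]; simpa using (M.sameCycle_σ_inv p).symm)
      (M.sameCycle_φ_σ_inv p')
      (by rw [← e1]; simpa using (M.sameCycle_σ_inv p').symm)
      (M.sameCycle_φ_σ_inv p)
    rw [M.α_invol] at hm
    have h3 : M.α (M.σ⁻¹ p) = M.σ⁻¹ p' := by
      rcases hm with hm | hm | hm | hm
      · refine absurd ?_ (h.not_sameCycle_σ_α hp)
        rw [← hm]; exact M.sameCycle_σ_inv p
      · refine absurd ?_ (h.deg p hp)
        rw [e2, ← hm]; simp
      · exact hm
      · exact absurd (e1.trans hm.symm) (h.σ_ne hp'd)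
    have h4 : M.σ (M.σ (M.σ p)) = p := by
      have : M.σ.SameCycle (M.α p') (M.φ (M.σ⁻¹ p')) := by
        rw [M.φ_apply, ← h3, M.α_invol, ← e2]; simp [Perm.SameCycle.rfl]
      have h5 := h.cell _ _ ((M.sameCycle_φ_σ_inv p').trans (sameCycle_apply_self _ _)) this
      rw [M.φ_apply, ← h3, M.α_invol] at h5
      rw [e2, h5]; simp
    have h5 : M.α (M.σ (M.σ p)) = M.σ⁻¹ p' := by
      rw [← h3]; congr 1; rw [Perm.eq_inv_iff_eq]; exact h4
    have h6 : M.σ (M.σ (M.σ p')) = p' := by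
      have : M.σ.SameCycle (M.α p) (M.φ (M.σ⁻¹ p)) := by
        rw [M.φ_apply, h3, ← e1]; simp [Perm.SameCycle.rfl]
      have h5 := h.cell _ _ ((M.sameCycle_φ_σ_inv p).trans (sameCycle_apply_self _ _)) this
      rw [M.φ_apply, h3] at h5
      rw [e1, h5]; simp
    have h7 : M.α (M.σ (M.σ p)) = M.σ (M.σ p') := by
      rw [h5, Perm.inv_eq_iff_eq, h6]
    have hedges : M.edges ⊆ {M.edge p, M.edge (M.σ p), M.edge (M.σ (M.σ p))} := by
      rintro _ ⟨z, hz, rfl⟩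
      have hcl : z = p ∨ z = M.σ p ∨ z = M.σ (M.σ p) ∨ z = p' ∨ z = M.σ p' ∨
          z = M.σ (M.σ p') := by
        have ia : ∀ w, M.α (M.α w) = w := M.α_invol
        induction h.connected p hp z hz with
        | refl => simp
        | tail hab hbc ih =>
          rename_i b c
          have hb := ih (by
            rcases hbc with rfl | rfl
            · intro hb; exact hz (by rw [M.σ_unused _ hb]; exact hb)
            · exact M.α_mem_darts.1 hz)
          rcases hbc with rfl | rfl <;> grind
      simp only [Set.mem_insert_iff, Set.mem_singleton_iff, edge_eq_iff]
      have ia : ∀ w, M.α (M.α w) = w := M.α_invol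
      grind
    have hE : M.edges.ncard ≤ 3 := by
      refine (Set.ncard_le_ncard hedges).trans ?_
      refine (Set.ncard_insert_le _ _).trans (Nat.succ_le_succ ?_)
      refine (Set.ncard_insert_le _ _).trans (Nat.succ_le_succ ?_)
      simp
    have hV : 1 < M.vertices.ncard := by
      rw [Set.one_lt_ncard]
      exact ⟨_, ⟨p, hp, rfl⟩, _, ⟨M.α p, M.α_mem_darts.2 hp, rfl⟩, fun hh =>
        h.not_sameCycle_σ_α hp ((M.vertex_eq_iff).1 hh)⟩
    have hF : 1 < M.faces.ncard := by
      rw [Set.one_lt_ncard]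
      exact ⟨_, ⟨p, hp, rfl⟩, _, ⟨M.α p, M.α_mem_darts.2 hp, rfl⟩, fun hh =>
        h.not_sameCycle_φ_α hp ((M.face_eq_iff).1 hh)⟩
    have := h.euler
    omega

end PrePolyhedral

theorem Polyhedral.simple {M : CombMap D} (h : Polyhedral M) {x y : D} (hx : x ∈ M.darts)
    (hy : y ∈ M.darts) (h1 : M.σ.SameCycle x y) (h2 : M.σ.SameCycle (M.α x) (M.α y)) :
    x = y := by
  -- otherwise the two edges bound a two-sided face
  have key : ∀ x ∈ M.darts, ∀ y, M.σ.SameCycle x y → M.α x = M.φ y → x = y := by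
    intro x hx y h1 h3
    have h4 : M.σ⁻¹ x = y := by
      refine h.cell _ _ ?_ ((M.sameCycle_σ_inv x).symm.trans h1)
      refine (M.sameCycle_φ_σ_inv x).symm.trans ?_
      rw [h3]; exact (sameCycle_apply_self _ _).symm
    refine absurd ?_ (h.face_deg y (M.mem_darts_of_sameCycle_σ h1 hx))
    rw [← h3, M.φ_α, h4]
  rcases h.meet x y (M.φ y) (M.φ x) h1 (sameCycle_apply_self _ _)
      ((M.sameCycle_σ_φ y).trans (h2.symm.trans (M.sameCycle_σ_φ x).symm))
      (sameCycle_apply_self _ _).symm with hm | hm | hm | hm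
  · exact absurd hm.symm (h.φ_ne hx)
  · exact hm
  · exact key x hx y h1 hm
  · exact (key y hy x h1.symm hm).symm

theorem three_le_ncard_vertex [Finite D] {M : CombMap D} {x : D} (h1 : M.σ (M.σ x) ≠ x) :
    3 ≤ (M.vertex x).ncard := by
  have h0 : M.σ x ≠ x := fun h' => h1 (by rw [h', h'])
  have h2 : M.σ (M.σ x) ≠ M.σ x := fun h' => h0 (M.σ.injective h')
  have hs : ({x, M.σ x, M.σ (M.σ x)} : Set D) ⊆ M.vertex x := by
    rintro z (rfl | rfl | rfl)
    · exact Perm.SameCycle.rfl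
    · exact sameCycle_apply_self _ _
    · exact (sameCycle_apply_self _ _).trans (sameCycle_apply_self _ _)
  refine le_trans (le_of_eq ?_) (Set.ncard_le_ncard hs)
  rw [Set.ncard_insert_of_notMem, Set.ncard_pair]
  all_goals grind

theorem Polyhedral.isTPM [Finite D] {M : CombMap D} (h : Polyhedral M) : M.IsTPM where
  nonempty := h.nonempty
  connected := h.connected
  euler := h.euler
  loopless x hx h' := h.not_sameCycle_σ_α hx (M.vertex_eq_iff.1 h')
  simple x hx y hy h1 h2 := h.simple hx hy (M.vertex_eq_iff.1 h1) (M.vertex_eq_iff.1 h2)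
  valence := by
    rintro _ ⟨x, hx, rfl⟩
    exact three_le_ncard_vertex (h.deg x hx)
  closedCell x _ y _ h1 h2 := h.cell x y (M.face_eq_iff.1 h1) (M.vertex_eq_iff.1 h2)
  meetProperly := by
    rintro _ ⟨x, hx, rfl⟩ _ ⟨y, hy, rfl⟩ hne _ ⟨u, hu, rfl⟩ _ ⟨v, hv, rfl⟩
      ⟨p, hp, hp'⟩ ⟨q, hq, hq'⟩ ⟨r, hr, hr'⟩ ⟨s, hs, hs'⟩
    have hpd := M.mem_darts_of_sameCycle_σ hp hu
    have hqd := M.mem_darts_of_sameCycle_σ hq hu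
    rcases h.meet p q s r (hp.symm.trans hq) (hq'.symm.trans hs') (hs.symm.trans hr)
      (hr'.symm.trans hp') with hm | hm | hm | hm
    · subst hm
      rw [M.vertex_eq_iff.2 (hp.trans hr.symm)]
    · subst hm
      exact absurd (M.face_eq_iff.2 (hp'.trans hq'.symm)) hne
    · refine .single ⟨p, hpd, ⟨p, by simp [edge], hp'⟩, ⟨M.α p, by simp [edge], by rwa [hm]⟩,
        M.vertex_eq_iff.2 hp, M.vertex_eq_iff.2 (by rw [hm]; exact hs)⟩
    · refine .single ⟨q, hqd, ⟨M.α q, by simp [edge], by rwa [hm]⟩, ⟨q, by simp [edge], hq'⟩,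
        M.vertex_eq_iff.2 hq, M.vertex_eq_iff.2 (by rw [hm]; exact hr)⟩

end Polyhedral
end CombMap

namespace CombMap

section

variable {D : Type*}

theorem IsToroidalMap.deg {M : CombMap D} (h : M.IsToroidalMap) {x : D} (hx : x ∈ M.darts) :
    M.σ (M.σ x) ≠ x := by
  intro hxx
  have hs : M.vertex x ⊆ {x, M.σ x} := by
    rintro z ⟨n, rfl⟩
    have : ∀ w ∈ ({x, M.σ x} : Set D), M.σ w ∈ ({x, M.σ x} : Set D) ∧
        M.σ⁻¹ w ∈ ({x, M.σ x} : Set D) := by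
      rintro w (rfl | hw)
      · refine ⟨by simp, Or.inr ?_⟩
        rw [Set.mem_singleton_iff]
        rw [Perm.inv_eq_iff_eq, hxx]
      · rw [Set.mem_singleton_iff] at hw; subst hw; exact ⟨by simp [hxx], by simp⟩
    induction n using Int.induction_on with
    | zero => simp
    | succ n ih => rw [add_comm, zpow_add]; exact (this _ ih).1
    | pred n ih => rw [sub_eq_neg_add, zpow_add]; exact (this _ ih).2
  have h3 := h.valence _ ⟨x, hx, rfl⟩
  have h4 : (M.vertex x).ncard ≤ 2 :=
    (Set.ncard_le_ncard hs (by simp)).trans ((Set.ncard_insert_le _ _).trans (by simp))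
  omega

/-- A connected intersection of two faces has at most one edge, because every vertex has valence
at least `3`. -/
theorem MeetProperly.eq_or_edge {M : CombMap D} (h : M.IsToroidalMap) {f g u v : D}
    (hf : f ∈ M.darts) (hg : g ∈ M.darts) (hfg : ¬ M.φ.SameCycle f g)
    (hp : Relation.ReflTransGen
        (fun a b => ∃ x ∈ M.darts, (M.edge x ∩ M.face f).Nonempty ∧
          (M.edge x ∩ M.face g).Nonempty ∧
          a = M.vertex x ∧ b = M.vertex (M.α x)) (M.vertex u) (M.vertex v)) :
    M.σ.SameCycle u v ∨ ∃ x, M.σ.SameCycle u x ∧ M.σ.SameCycle v (M.α x) ∧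
      (M.φ.SameCycle f x ∧ M.φ.SameCycle g (M.α x) ∨
        M.φ.SameCycle g x ∧ M.φ.SameCycle f (M.α x)) := by
  have hcell : ∀ x ∈ M.darts, ∀ y, M.φ.SameCycle x y → M.σ.SameCycle x y → x = y :=
    fun x hx y h1 h2 => h.closedCell x hx y (M.mem_darts_of_sameCycle_σ h2 hx)
      (M.face_eq_iff.2 h1) (M.vertex_eq_iff.2 h2)
  have hstep : ∀ x, (M.edge x ∩ M.face f).Nonempty → (M.edge x ∩ M.face g).Nonempty →
      (M.φ.SameCycle f x ∧ M.φ.SameCycle g (M.α x) ∨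
        M.φ.SameCycle g x ∧ M.φ.SameCycle f (M.α x)) := by
    rintro x ⟨a, (rfl | ha), ha'⟩ ⟨b, (rfl | hb), hb'⟩
    · exact absurd (ha'.trans hb'.symm) hfg
    · rw [Set.mem_singleton_iff] at hb; subst hb; exact Or.inl ⟨ha', hb'⟩
    · rw [Set.mem_singleton_iff] at ha; subst ha; exact Or.inr ⟨hb', ha'⟩
    · rw [Set.mem_singleton_iff] at ha hb; subst ha; subst hb
      exact absurd (ha'.trans hb'.symm) hfg
  -- two consecutive edges of the intersection with the same order of the faces are impossible
  have hback : ∀ f g, f ∈ M.darts → ∀ x y, M.σ.SameCycle (M.α x) y →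
      M.φ.SameCycle f x → M.φ.SameCycle g (M.α x) → M.φ.SameCycle f y →
      M.φ.SameCycle g (M.α y) → False := by
    intro f g hf x y hxy h1 h2 h3 h4
    have hx := M.mem_darts_of_sameCycle_φ h1 hf
    have hy := M.mem_darts_of_sameCycle_φ h3 hf
    have e1 := hcell (M.φ x) (M.mem_darts_of_sameCycle_φ (sameCycle_apply_self _ _) hx) y
      ((sameCycle_apply_self M.φ x).symm.trans (h1.symm.trans h3)) ((M.sameCycle_σ_φ x).trans hxy)
    have e2 := hcell _ (M.α_mem_darts.2 hx) (M.σ⁻¹ y)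
      (h2.symm.trans (h4.trans (M.sameCycle_φ_σ_inv y))) (hxy.trans (M.sameCycle_σ_inv y))
    have e3 : M.σ (M.α x) = y := by rw [e2]; simp
    refine h.deg (M.α_mem_darts.2 hx) ?_
    rw [e3, ← e1, M.σ_φ]
  have key : ∀ w, Relation.ReflTransGen
        (fun a b => ∃ x ∈ M.darts, (M.edge x ∩ M.face f).Nonempty ∧
          (M.edge x ∩ M.face g).Nonempty ∧
          a = M.vertex x ∧ b = M.vertex (M.α x)) (M.vertex u) w →
      w = M.vertex u ∨ ∃ x, M.vertex u = M.vertex x ∧ w = M.vertex (M.α x) ∧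
        (M.φ.SameCycle f x ∧ M.φ.SameCycle g (M.α x) ∨
          M.φ.SameCycle g x ∧ M.φ.SameCycle f (M.α x)) := by
    intro w hw
    induction hw with
    | refl => exact Or.inl rfl
    | tail _ hbc ih =>
      obtain ⟨y, hy, hy1, hy2, rfl, rfl⟩ := hbc
      have hy3 := hstep y hy1 hy2
      rcases ih with ih | ⟨x, hx1, hx2, hx3⟩
      · exact Or.inr ⟨y, ih.symm, rfl, hy3⟩
      · left
        have hxy := M.vertex_eq_iff.1 hx2.symm
        have hfin : y = M.α x → M.vertex (M.α y) = M.vertex u := by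
          rintro rfl; rw [M.α_invol, hx1]
        rcases hx3 with ⟨h1, h2⟩ | ⟨h1, h2⟩ <;> rcases hy3 with ⟨h3, h4⟩ | ⟨h3, h4⟩
        · exact (hback f g hf x y hxy h1 h2 h3 h4).elim
        · exact hfin (hcell y hy _ (h3.symm.trans h2) hxy.symm)
        · exact hfin (hcell y hy _ (h3.symm.trans h2) hxy.symm)
        · exact (hback g f hg x y hxy h1 h2 h3 h4).elim
  rcases key _ hp with hw | ⟨x, h1, h2, h3⟩
  · exact Or.inl (M.vertex_eq_iff.1 hw.symm)
  · exact Or.inr ⟨x, M.vertex_eq_iff.1 h1, M.vertex_eq_iff.1 h2, h3⟩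

theorem IsTPM.polyhedral {M : CombMap D} (h : M.IsTPM) : Polyhedral M where
  nonempty := h.nonempty
  connected := h.connected
  euler := h.euler
  cell x y h1 h2 := by
    by_cases hx : x ∈ M.darts
    · exact h.closedCell x hx y (M.mem_darts_of_sameCycle_σ h2 hx)
        (M.face_eq_iff.2 h1) (M.vertex_eq_iff.2 h2)
    · exact h2.eq_of_left (M.σ_eq_self_of_notMem hx)
  deg x hx := h.deg hx
  meet p q s r h1 h2 h3 h4 := by
    by_cases hp : p ∈ M.darts
    swap
    · exact Or.inr (Or.inl (h1.eq_of_left (M.σ_eq_self_of_notMem hp)))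
    have hq := M.mem_darts_of_sameCycle_σ h1 hp
    have hr := M.mem_darts_of_sameCycle_φ h4.symm hp
    have hs := M.mem_darts_of_sameCycle_φ h2 hq
    have hcell : ∀ x ∈ M.darts, ∀ y, M.φ.SameCycle x y → M.σ.SameCycle x y → x = y :=
      fun x hx y h1 h2 => h.closedCell x hx y (M.mem_darts_of_sameCycle_σ h2 hx)
        (M.face_eq_iff.2 h1) (M.vertex_eq_iff.2 h2)
    by_cases hpq : M.φ.SameCycle p q
    · exact Or.inr (Or.inl (hcell p hp q hpq h1))
    have hm := h.meetProperly _ ⟨p, hp, rfl⟩ _ ⟨q, hq, rfl⟩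
      (fun hh => hpq (M.face_eq_iff.1 hh)) _ ⟨p, hp, rfl⟩ _ ⟨r, hr, rfl⟩
      ⟨p, .rfl, .rfl⟩ ⟨q, h1, .rfl⟩ ⟨r, .rfl, h4.symm⟩ ⟨s, h3.symm, h2⟩
    rcases MeetProperly.eq_or_edge h.toIsToroidalMap hp hq hpq hm with
      h5 | ⟨x, h5, h6, ⟨h7, h8⟩ | ⟨h7, h8⟩⟩
    · exact Or.inl (hcell p hp r h4.symm h5)
    · have := hcell p hp x h7 h5
      subst this
      exact Or.inr (Or.inr (Or.inl (hcell _ (M.α_mem_darts.2 hp) s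
        (h8.symm.trans h2) (h6.symm.trans h3.symm))))
    · have := hcell q hq x h7 (h1.symm.trans h5)
      subst this
      exact Or.inr (Or.inr (Or.inr (hcell _ (M.α_mem_darts.2 hq) r
        (h8.symm.trans h4.symm) h6.symm)))
  face_deg x hx hxx := by
    have h1 := sameCycle_apply_self M.φ x
    have hy := M.mem_darts_of_sameCycle_φ h1 hx
    have h2 := h.simple x hx (M.α (M.φ x)) (M.α_mem_darts.2 hy)
      (M.vertex_eq_iff.2 (by nth_rw 1 [← hxx]; exact M.sameCycle_σ_φ _))
      (M.vertex_eq_iff.2 (by rw [M.α_invol]; exact (M.sameCycle_σ_φ _).symm))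
    have h3 : M.α x = M.φ x := by nth_rw 1 [h2]; rw [M.α_invol]
    refine h.deg hy ?_
    rw [M.σ_φ, h3, M.σ_φ, h3]

/-! ### Duality -/

/-- The dual map: it has the same darts, its vertices are the faces of `M` and its faces are the
vertices of `M`, as sets of darts. (The rotation is `φ⁻¹`, so that no reversal of darts is needed to
identify the faces of the dual with the vertices.) -/
def dual (M : CombMap D) : CombMap D where
  σ := M.α * M.σ
  α := M.α
  α_invol := M.α_invol
  σ_unused x hx := by rw [Perm.mul_apply, M.σ_unused x hx, hx]

variable (M : CombMap D)

theorem ext_perm {M N : CombMap D} (h1 : M.σ = N.σ) (h2 : M.α = N.α) : M = N := by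
  cases M; cases N; cases h1; cases h2; rfl

theorem dual_dual : M.dual.dual = M :=
  ext_perm (by ext x; simp [dual, M.α_invol]) rfl

theorem dual_darts : M.dual.darts = M.darts := rfl

theorem dual_α : M.dual.α = M.α := rfl

theorem dual_σ : M.dual.σ = M.φ⁻¹ := by
  rw [φ, mul_inv_rev, inv_inv, M.α_inv]; rfl

theorem dual_φ : M.dual.φ = M.σ⁻¹ := by
  change (M.α * M.σ)⁻¹ * M.α = M.σ⁻¹
  rw [mul_inv_rev, inv_mul_cancel_right]

theorem dual_sameCycle_σ {x y : D} : M.dual.σ.SameCycle x y ↔ M.φ.SameCycle x y := by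
  rw [dual_σ, Perm.sameCycle_inv]

theorem dual_sameCycle_φ {x y : D} : M.dual.φ.SameCycle x y ↔ M.σ.SameCycle x y := by
  rw [dual_φ, Perm.sameCycle_inv]

theorem dual_vertices : M.dual.vertices = M.faces := by
  have : M.dual.vertex = M.face := by
    ext x y; exact M.dual_sameCycle_σ
  rw [vertices, faces, this, dual_darts]

theorem dual_faces : M.dual.faces = M.vertices := by
  rw [← dual_vertices, dual_dual]

theorem dual_connected {M : CombMap D} (h : M.Connected) : M.dual.Connected := by
  intro x hx y hy
  have hα : ∀ a, Relation.ReflTransGen (fun a b => b = M.dual.σ a ∨ b = M.dual.α a) a (M.α a) :=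
    fun a => .single (Or.inr rfl)
  induction h x hx y hy with
  | refl => exact .refl
  | tail hab hbc ih =>
    rename_i b c
    have hb : b ∈ M.darts := by
      rcases hbc with rfl | rfl
      · intro hb; exact hy (by rw [M.σ_unused _ hb]; exact hb)
      · exact M.α_mem_darts.1 hy
    refine (ih hb).trans ?_
    rcases hbc with rfl | rfl
    · have h1 := hα (M.α (M.σ b))
      rw [M.α_invol] at h1
      exact .trans (.single (Or.inl rfl)) h1
    · exact hα b

theorem Polyhedral.dual {M : CombMap D} (h : Polyhedral M) : Polyhedral M.dual where
  nonempty := h.nonempty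
  connected := dual_connected h.connected
  euler := by
    rw [M.dual_vertices, M.dual_faces, add_comm]; exact h.euler
  cell x y h1 h2 := h.cell x y (M.dual_sameCycle_σ.1 h2) (M.dual_sameCycle_φ.1 h1)
  deg x hx hh := by
    rw [dual_σ, Perm.inv_eq_iff_eq, Perm.inv_eq_iff_eq] at hh
    exact h.face_deg x hx hh.symm
  face_deg x hx hh := by
    rw [dual_φ, Perm.inv_eq_iff_eq, Perm.inv_eq_iff_eq] at hh
    exact h.deg x hx hh.symm
  meet p q s r h1 h2 h3 h4 := by
    rw [dual_sameCycle_σ] at h1 h3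
    rw [dual_sameCycle_φ] at h2 h4
    rw [dual_α]
    have ia := M.α_invol
    rcases h.meet p r s q h4.symm h3.symm h2.symm h1.symm with hm | hm | hm | hm <;> grind

variable [DecidableEq D]

theorem deleteEdge_α (x y : D) :
    (M.deleteEdge x).α y = if y = x ∨ y = M.α x then y else M.α y := by
  have h1 := M.α_invol
  simp only [deleteEdge, Perm.mul_apply, swap_apply_def]
  grind

theorem contractEdge_eq_dual (x : D) : M.contractEdge x = (M.dual.deleteEdge x).dual := by
  have h1 := M.α_invol
  refine ext_perm ?_ rfl
  ext y
  change _ = (M.dual.deleteEdge x).α ((M.dual.deleteEdge x).σ y)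
  rw [deleteEdge_α]
  simp only [contractEdge, deleteEdge, dropPoint_dropPoint_apply, dual, Perm.mul_apply,
    swap_apply_def]
  have hi : ∀ a b, M.σ a = M.σ b → a = b := fun a b h => M.σ.injective h
  grind

/-- Coalescing at a 2-valent vertex is dual to removing a two-sided face. -/
theorem dual_fuse {x y : D} (hx : x ∈ M.darts) (hy : y ∈ M.darts) (hxy : x ≠ y)
    (h1 : M.σ x = y) (h2 : M.σ y = x) :
    (M.fuse x y hx hy hxy).dual = M.dual.fuse x y hx hy hxy := by
  have i := M.α_invol
  refine ext_perm ?_ rfl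
  ext z
  change (M.fuse x y hx hy hxy).α ((M.fuse x y hx hy hxy).σ z) =
    dropPoint (dropPoint (M.α * M.σ) x) y z
  have hx' : M.α x ≠ x := hx
  have hy' : M.α y ≠ y := hy
  have := M.fuse_aux x y hx hy hxy
  simp only [fuse, this, dropPoint_dropPoint_apply, Perm.mul_apply]
  have hi : ∀ a b, M.σ a = M.σ b → a = b := fun a b h => M.σ.injective h
  clear this
  grind

theorem CoalesceStep.dual {M N : CombMap D} (h : CoalesceStep M N) :
    DigonStep M.dual N.dual := by
  obtain ⟨x, y, hx, hy, hxy, h1, h2, h3, rfl⟩ := h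
  refine ⟨x, y, hx, hy, hxy, ?_, ?_, h3, M.dual_fuse hx hy hxy h1 h2⟩
  · rw [dual_φ, Perm.inv_eq_iff_eq, h2]
  · rw [dual_φ, Perm.inv_eq_iff_eq, h1]

end
end CombMap

namespace CombMap

/-! ### Deleting an edge -/

theorem reflTransGen_of_sameCycle_σ {D : Type*} [Finite D] {M : CombMap D} {y z : D}
    (h : M.σ.SameCycle y z) :
    Relation.ReflTransGen (fun a b => b = M.σ a ∨ b = M.α a) y z :=
  sameCycle_induction h .refl fun _ _ hw => hw.tail (Or.inl rfl)

theorem reflTransGen_of_sameCycle_φ {D : Type*} [Finite D] {M : CombMap D} {y z : D}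
    (h : M.φ.SameCycle y z) :
    Relation.ReflTransGen (fun a b => b = M.σ a ∨ b = M.α a) y z :=
  sameCycle_induction h .refl fun w _ hw =>
    (hw.tail (Or.inr rfl)).trans (reflTransGen_of_sameCycle_σ (M.sameCycle_σ_φ w).symm)

theorem mem_darts_of_step {D : Type*} {M : CombMap D} {b c : D} (hbc : c = M.σ b ∨ c = M.α b)
    (hc : c ∈ M.darts) : b ∈ M.darts := by
  rcases hbc with rfl | rfl
  · intro hb; exact hc (by rw [M.σ_unused _ hb]; exact hb)
  · exact M.α_mem_darts.1 hc

section

variable {D : Type*} [DecidableEq D] (M : CombMap D)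

theorem mem_darts_deleteEdge {x y : D} :
    y ∈ (M.deleteEdge x).darts ↔ y ∈ M.darts ∧ y ≠ x ∧ y ≠ M.α x := by
  change (M.deleteEdge x).α y ≠ y ↔ M.α y ≠ y ∧ _
  rw [deleteEdge_α]
  split_ifs <;> grind

theorem deleteEdge_eq_dual (x : D) : M.deleteEdge x = (M.dual.contractEdge x).dual := by
  rw [contractEdge_eq_dual, dual_dual, dual_dual]

variable [Finite D]

theorem deleteEdge_sameCycle_σ {x y z : D} (hy : y ≠ x) (hy' : y ≠ M.α x) (hz : z ≠ x)
    (hz' : z ≠ M.α x) : (M.deleteEdge x).σ.SameCycle y z ↔ M.σ.SameCycle y z := by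
  change (dropPoint (dropPoint M.σ x) (M.α x)).SameCycle y z ↔ _
  rw [sameCycle_dropPoint _ hy' hz', sameCycle_dropPoint _ hy hz]

/-- Deleting an edge merges the two faces at it. This is dual to the merging of the two ends of a
contracted edge. -/
theorem deleteEdge_sameCycle_φ {x y z : D} (hx : ¬ M.φ.SameCycle x (M.α x))
    (hy : y ≠ x) (hy' : y ≠ M.α x) (hz : z ≠ x) (hz' : z ≠ M.α x) :
    (M.deleteEdge x).φ.SameCycle y z ↔ M.φ.SameCycle y z ∨
      ((M.φ.SameCycle x y ∨ M.φ.SameCycle (M.α x) y) ∧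
        (M.φ.SameCycle x z ∨ M.φ.SameCycle (M.α x) z)) := by
  rw [deleteEdge_eq_dual, dual_sameCycle_φ]
  change (dropPoint (dropPoint (M.dual.σ * swap x (M.α x)) x) (M.α x)).SameCycle y z ↔ _
  rw [sameCycle_dropPoint _ hy' hz', sameCycle_dropPoint _ hy hz, sameCycle_mul_swap]
  · simp only [dual_sameCycle_σ]
  · rwa [dual_sameCycle_σ]

variable {M}

theorem Polyhedral.deleteEdge_connected (h : Polyhedral M) {x : D} (hx : x ∈ M.darts) :
    (M.deleteEdge x).Connected := by
  intro y hy z hz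
  rw [mem_darts_deleteEdge] at hy hz
  set N := M.deleteEdge x with hN
  let R := Relation.ReflTransGen (fun a b => b = N.σ a ∨ b = N.α a) y
  have hV : ∀ a b, a ≠ x → a ≠ M.α x → b ≠ x → b ≠ M.α x → M.σ.SameCycle a b → R a → R b :=
    fun a b h1 h2 h3 h4 h5 h6 => h6.trans
      (reflTransGen_of_sameCycle_σ ((M.deleteEdge_sameCycle_σ h1 h2 h3 h4).2 h5))
  have hF : ∀ a b, a ≠ x → a ≠ M.α x → b ≠ x → b ≠ M.α x → M.φ.SameCycle a b → R a → R b :=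
    fun a b h1 h2 h3 h4 h5 h6 => h6.trans (reflTransGen_of_sameCycle_φ
      ((M.deleteEdge_sameCycle_φ (h.not_sameCycle_φ_α hx) h1 h2 h3 h4).2 (Or.inl h5)))
  -- the rest of the boundary of the face of `t` bypasses the edge
  have hbypass : ∀ t, t ∈ M.darts → (t = x ∨ t = M.α x) →
      (∀ b, M.σ.SameCycle t b → b ≠ x → b ≠ M.α x → R b) →
      ∀ b, M.σ.SameCycle (M.α t) b → b ≠ x → b ≠ M.α x → R b := by
    intro t ht htx hR b hb hb1 hb2
    have hset : ∀ a, a ≠ x ∧ a ≠ M.α x ↔ a ≠ t ∧ a ≠ M.α t := by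
      intro a
      rcases htx with rfl | rfl
      · rfl
      · rw [M.α_invol, and_comm]
    have hns := h.not_sameCycle_σ_α ht
    have hnf := h.not_sameCycle_φ_α ht
    have h1 : M.σ t ≠ x ∧ M.σ t ≠ M.α x := (hset _).2
      ⟨h.σ_ne ht, fun hh => hns (hh ▸ sameCycle_apply_self M.σ t)⟩
    have h2 : M.α (M.σ t) ≠ x ∧ M.α (M.σ t) ≠ M.α x := (hset _).2
      ⟨fun hh => hns (by
        have : M.α t = M.σ t := by rw [← hh, M.α_invol, hh]
        rw [this]; exact sameCycle_apply_self _ _),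
       fun hh => h.σ_ne ht (M.α.injective hh)⟩
    have h3 : M.φ t ≠ x ∧ M.φ t ≠ M.α x := (hset _).2
      ⟨h.φ_ne ht, fun hh => hnf (hh ▸ sameCycle_apply_self M.φ t)⟩
    have r1 : R (M.σ t) := hR _ (sameCycle_apply_self _ _) h1.1 h1.2
    have r2 : R (M.α (M.σ t)) := r1.tail (Or.inr (by
      rw [hN, deleteEdge_α, if_neg (not_or.2 h1)]))
    have r3 : R (M.φ t) := hF _ _ h2.1 h2.2 h3.1 h3.2
      ((M.sameCycle_φ_α_σ t).trans (sameCycle_apply_self _ _)) r2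
    exact hV _ _ h3.1 h3.2 hb1 hb2 ((M.sameCycle_σ_φ t).trans hb) r3
  have key : ∀ w, w ∈ M.darts → Relation.ReflTransGen (fun a b => b = M.σ a ∨ b = M.α a) y w →
      ∀ b, M.σ.SameCycle w b → b ≠ x → b ≠ M.α x → R b := by
    intro w hw hyw
    induction hyw with
    | refl =>
      intro b hb hb1 hb2
      exact hV y b hy.2.1 hy.2.2 hb1 hb2 hb .refl
    | tail hab hbc ih =>
      rename_i v w
      have hv := mem_darts_of_step hbc hw
      have ih := ih hv
      rcases hbc with rfl | rfl
      · intro b hb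
        exact ih b (Perm.sameCycle_apply_left.1 hb)
      · by_cases hvx : v = x ∨ v = M.α x
        · exact hbypass v hv hvx ih
        · intro b hb hb1 hb2
          have hαv : M.α v ≠ x ∧ M.α v ≠ M.α x := by
            have := M.α_invol v
            have := M.α_invol x
            grind
          refine hV (M.α v) b hαv.1 hαv.2 hb1 hb2 hb ?_
          have rv : R v := ih v .rfl (fun hh => hvx (Or.inl hh)) fun hh => hvx (Or.inr hh)
          exact rv.tail (Or.inr (by rw [hN, deleteEdge_α, if_neg hvx]))
  exact key z hz.1 (h.connected y hy.1 z hz.1) z .rfl hz.2.1 hz.2.2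

theorem Polyhedral.deleteEdge_euler (h : Polyhedral M) {x : D} (hx : x ∈ M.darts) :
    (M.deleteEdge x).vertices.ncard + (M.deleteEdge x).faces.ncard =
      (M.deleteEdge x).edges.ncard := by
  have hx' := M.α_mem_darts.2 hx
  have hA : (M.deleteEdge x).darts ⊆ M.darts := fun y hy => (M.mem_darts_deleteEdge.1 hy).1
  have hns := h.not_sameCycle_σ_α hx
  have hnf := h.not_sameCycle_φ_α hx
  have hV : (M.deleteEdge x).vertices.ncard = M.vertices.ncard := by
    refine ncard_classes_restrict hA ?_ ?_
    · intro w hw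
      have : ∀ t ∈ M.darts, (t = x ∨ t = M.α x) →
          ∃ w' ∈ (M.deleteEdge x).darts, M.vertex w' = M.vertex t := by
        intro t ht htx
        have hns' := h.not_sameCycle_σ_α ht
        have h1 := sameCycle_apply_self M.σ t
        refine ⟨M.σ t, M.mem_darts_deleteEdge.2 ⟨M.σ_mem_darts ht, ?_⟩,
          M.vertex_eq_iff.2 h1.symm⟩
        rcases htx with rfl | rfl
        · exact ⟨h.σ_ne ht, fun hh => hns (hh ▸ h1)⟩
        · exact ⟨fun hh => hns (hh ▸ h1).symm, h.σ_ne ht⟩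
      by_cases h1 : w = x ∨ w = M.α x
      · exact this w hw h1
      · exact ⟨w, M.mem_darts_deleteEdge.2 ⟨hw, not_or.1 h1⟩, rfl⟩
    · intro y hy z hz
      rw [mem_darts_deleteEdge] at hy hz
      rw [vertex_eq_iff, vertex_eq_iff, M.deleteEdge_sameCycle_σ hy.2.1 hy.2.2 hz.2.1 hz.2.2]
  have hF : (M.deleteEdge x).faces.ncard + 1 = M.faces.ncard := by
    refine ncard_classes_merge hA hx hx' (fun hh => hnf (M.face_eq_iff.1 hh)) ?_ ?_
    · intro w hw
      have : ∀ t ∈ M.darts, (t = x ∨ t = M.α x) →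
          ∃ w' ∈ (M.deleteEdge x).darts, M.face w' = M.face t := by
        intro t ht htx
        have h1 := sameCycle_apply_self M.φ t
        refine ⟨M.φ t, M.mem_darts_deleteEdge.2 ⟨M.mem_darts_of_sameCycle_φ h1 ht, ?_⟩,
          M.face_eq_iff.2 h1.symm⟩
        rcases htx with rfl | rfl
        · exact ⟨h.φ_ne ht, fun hh => hnf (hh ▸ h1)⟩
        · exact ⟨fun hh => hnf (hh ▸ h1).symm, h.φ_ne ht⟩
      by_cases h1 : w = x ∨ w = M.α x
      · exact this w hw h1
      · exact ⟨w, M.mem_darts_deleteEdge.2 ⟨hw, not_or.1 h1⟩, rfl⟩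
    · intro y hy z hz
      rw [mem_darts_deleteEdge] at hy hz
      simp only [face_eq_iff]
      rw [M.deleteEdge_sameCycle_φ hnf hy.2.1 hy.2.2 hz.2.1 hz.2.2]
      simp only [Perm.sameCycle_comm (x := x), Perm.sameCycle_comm (x := M.α x)]
  have hE : (M.deleteEdge x).edges.ncard + 1 = M.edges.ncard := by
    refine ncard_classes_remove hA hx ?_ ?_ ?_
    · intro w hw
      by_cases h1 : w = x ∨ w = M.α x
      · exact Or.inl ((M.edge_eq_iff).2 h1).symm
      · exact Or.inr ⟨w, M.mem_darts_deleteEdge.2 ⟨hw, not_or.1 h1⟩, rfl⟩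
    · intro w hw hh
      rw [mem_darts_deleteEdge] at hw
      have := (M.edge_eq_iff).1 hh.symm
      tauto
    · intro y hy z hz
      rw [mem_darts_deleteEdge] at hy hz
      rw [edge_eq_iff, edge_eq_iff, deleteEdge_α, if_neg (not_or.2 hy.2)]
  have := h.euler
  omega

/-! ### Coalescing the edges at a 2-valent vertex -/

end

section Fuse

variable {D : Type*} [DecidableEq D] {M : CombMap D} {x y : D}
  (hx : x ∈ M.darts) (hy : y ∈ M.darts) (hxy : x ≠ y)

theorem fuse_α (z : D) : (M.fuse x y hx hy hxy).α z =
    if z = x ∨ z = y then z else if z = M.α x then M.α y else if z = M.α y then M.α x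
      else M.α z :=
  M.fuse_aux x y hx hy hxy z

theorem mem_darts_fuse {z : D} :
    z ∈ (M.fuse x y hx hy hxy).darts ↔ z ∈ M.darts ∧ z ≠ x ∧ z ≠ y := by
  change (M.fuse x y hx hy hxy).α z ≠ z ↔ M.α z ≠ z ∧ _
  rw [fuse_α]
  have hx' : M.α x ≠ x := hx
  have hy' : M.α y ≠ y := hy
  have i1 := M.α_invol x
  have i2 := M.α_invol y
  have i3 := M.α_invol z
  split_ifs <;> grind

theorem fuse_σ (h1 : M.σ x = y) (h2 : M.σ y = x) (z : D) : (M.fuse x y hx hy hxy).σ z =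
    if z = x ∨ z = y then z else M.σ z := by
  change dropPoint (dropPoint M.σ x) y z = _
  rw [dropPoint_dropPoint_apply]
  have hi : ∀ a b, M.σ a = M.σ b → a = b := fun a b h => M.σ.injective h
  split_ifs <;> grind

theorem fuse_connected (h1 : M.σ x = y) (h2 : M.σ y = x) (h3 : M.α x ≠ y)
    (h : M.Connected) : (M.fuse x y hx hy hxy).Connected := by
  intro a ha b hb
  rw [mem_darts_fuse] at ha hb
  set N := M.fuse x y hx hy hxy
  have hx' : M.α x ≠ x := hx
  have hy' : M.α y ≠ y := hy
  have i := M.α_invol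
  have hi : ∀ a b, M.σ a = M.σ b → a = b := fun a b h => M.σ.injective h
  let R := Relation.ReflTransGen (fun a b => b = N.σ a ∨ b = N.α a) a
  have hσ : ∀ w, w ≠ x → w ≠ y → R w → R (M.σ w) := fun w hw hw' hR => hR.tail (Or.inl (by
    rw [fuse_σ hx hy hxy h1 h2, if_neg (not_or.2 ⟨hw, hw'⟩)]))
  have hα : ∀ w, R w → R (N.α w) := fun w hR => hR.tail (Or.inr rfl)
  have hα' : ∀ z, N.α z = if z = x ∨ z = y then z else if z = M.α x then M.α y
    else if z = M.α y then M.α x else M.α z := fuse_α hx hy hxy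
  have key : ∀ w, w ∈ M.darts → Relation.ReflTransGen (fun a b => b = M.σ a ∨ b = M.α a) a w →
      if w = x ∨ w = y then R (M.α x) ∧ R (M.α y) else R w := by
    intro w hw haw
    induction haw with
    | refl => rw [if_neg (not_or.2 ha.2)]
    | tail hab hbc ih =>
      rename_i v w
      have ih := ih (mem_darts_of_step hbc hw)
      have e1 := hα v
      have e2 := hα' v
      have e3 := hα (M.α x)
      have e4 := hα' (M.α x)
      have e5 := hα (M.α y)
      have e6 := hα' (M.α y)
      have e7 := hσ v
      rcases hbc with rfl | rfl <;> grind
  have := key b hb.1 (h a ha.1 b hb.1)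
  rwa [if_neg (not_or.2 hb.2)] at this

variable [Finite D]

theorem fuse_sameCycle_σ {a b : D} (ha : a ≠ x) (ha' : a ≠ y) (hb : b ≠ x) (hb' : b ≠ y) :
    (M.fuse x y hx hy hxy).σ.SameCycle a b ↔ M.σ.SameCycle a b := by
  change (dropPoint (dropPoint M.σ x) y).SameCycle a b ↔ _
  rw [sameCycle_dropPoint _ ha' hb', sameCycle_dropPoint _ ha hb]

theorem fuse_sameCycle_φ (h1 : M.σ x = y) (h2 : M.σ y = x) {a b : D}
    (ha : a ≠ x) (ha' : a ≠ y) (hb : b ≠ x) (hb' : b ≠ y) :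
    (M.fuse x y hx hy hxy).φ.SameCycle a b ↔ M.φ.SameCycle a b := by
  rw [← dual_sameCycle_σ, ← M.dual_sameCycle_σ, M.dual_fuse hx hy hxy h1 h2]
  exact fuse_sameCycle_σ (M := M.dual) hx hy hxy ha ha' hb hb'

theorem fuse_euler (h1 : M.σ x = y) (h2 : M.σ y = x) (h3 : M.α x ≠ y)
    (h : M.vertices.ncard + M.faces.ncard = M.edges.ncard) :
    (M.fuse x y hx hy hxy).vertices.ncard + (M.fuse x y hx hy hxy).faces.ncard =
      (M.fuse x y hx hy hxy).edges.ncard := by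
  set N := M.fuse x y hx hy hxy
  have hx' : M.α x ≠ x := hx
  have hy' : M.α y ≠ y := hy
  have i := M.α_invol
  have hd : ∀ z, z ∈ N.darts ↔ z ∈ M.darts ∧ z ≠ x ∧ z ≠ y :=
    fun z => mem_darts_fuse hx hy hxy
  have hA : N.darts ⊆ M.darts := fun z hz => ((hd z).1 hz).1
  have hαx : M.α x ∈ N.darts := (hd _).2 ⟨M.α_mem_darts.2 hx, hx', h3⟩
  have hαy : M.α y ∈ N.darts := (hd _).2 ⟨M.α_mem_darts.2 hy, fun hh => h3 (by rw [← hh, i]), hy'⟩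
  have hV : N.vertices.ncard + 1 = M.vertices.ncard := by
    have hxy' : M.vertex y = M.vertex x :=
      M.vertex_eq_iff.2 (by rw [← h1]; exact (sameCycle_apply_self _ _).symm)
    have hmem : ∀ w, M.σ.SameCycle x w → w = x ∨ w = y := fun w hw =>
      sameCycle_induction (E := fun w => w = x ∨ w = y) hw (Or.inl rfl) fun v _ hv => by
        rcases hv with rfl | rfl
        · exact Or.inr h1
        · exact Or.inl h2
    refine ncard_classes_remove hA hx ?_ ?_ ?_
    · intro w hw
      by_cases h5 : w = x ∨ w = y
      · rcases h5 with rfl | rfl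
        · exact Or.inl rfl
        · exact Or.inl hxy'
      · exact Or.inr ⟨w, (hd w).2 ⟨hw, not_or.1 h5⟩, rfl⟩
    · intro w hw hh
      exact not_or.2 ((hd w).1 hw).2 (hmem w (M.vertex_eq_iff.1 hh.symm))
    · intro a ha b hb
      rw [hd] at ha hb
      rw [vertex_eq_iff, vertex_eq_iff,
        fuse_sameCycle_σ hx hy hxy ha.2.1 ha.2.2 hb.2.1 hb.2.2]
  have hF : N.faces.ncard = M.faces.ncard := by
    refine ncard_classes_restrict hA ?_ ?_
    · intro w hw
      by_cases h5 : w = x ∨ w = y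
      · rcases h5 with rfl | rfl
        · refine ⟨M.α y, hαy, M.face_eq_iff.2 ?_⟩
          rw [← h1]; exact M.sameCycle_φ_α_σ w
        · refine ⟨M.α x, hαx, M.face_eq_iff.2 ?_⟩
          rw [← h2]; exact M.sameCycle_φ_α_σ w
      · exact ⟨w, (hd w).2 ⟨hw, not_or.1 h5⟩, rfl⟩
    · intro a ha b hb
      rw [hd] at ha hb
      rw [face_eq_iff, face_eq_iff,
        fuse_sameCycle_φ hx hy hxy h1 h2 ha.2.1 ha.2.2 hb.2.1 hb.2.2]
  have hE : N.edges.ncard + 1 = M.edges.ncard := by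
    refine ncard_classes_merge hA hx hy ?_ ?_ ?_
    · intro hh
      rcases M.edge_eq_iff.1 hh with h5 | h5
      · exact hxy h5.symm
      · exact h3 h5.symm
    · intro w hw
      by_cases h5 : w = x ∨ w = y
      · rcases h5 with rfl | rfl
        · exact ⟨M.α w, hαx, (M.edge_eq_iff).2 (Or.inr (i w).symm)⟩
        · exact ⟨M.α w, hαy, (M.edge_eq_iff).2 (Or.inr (i w).symm)⟩
      · exact ⟨w, (hd w).2 ⟨hw, not_or.1 h5⟩, rfl⟩
    · intro a ha b hb
      rw [hd] at ha hb
      simp only [edge_eq_iff]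
      rw [show N.α a = _ from fuse_α hx hy hxy a]
      have i1 := i a
      have i2 := i b
      have i3 := i x
      have i4 := i y
      clear i
      split_ifs <;> grind
  omega

end Fuse
end CombMap

namespace CombMap

section

variable {D : Type*} {M : CombMap D}

/-! ### Removing an edge -/

/-- `N` arises from `M` by deleting the edge of `x` and then coalescing the two edges at the
initial vertex of `x` if `P` holds, and those at the initial vertex of `α x` if `Q` holds. Vertices
and faces of `N` are described as orbits of `M` restricted to the remaining darts, the two faces at
the edge being merged. -/
structure IsRemoval (M : CombMap D) (x : D) (P Q : Prop) (N : CombMap D) : Prop where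
  connected : N.Connected
  euler : N.vertices.ncard + N.faces.ncard = N.edges.ncard
  mem : ∀ y, y ∈ N.darts ↔ y ∈ M.darts ∧ y ≠ x ∧ y ≠ M.α x ∧
    ¬ (P ∧ M.σ.SameCycle x y) ∧ ¬ (Q ∧ M.σ.SameCycle (M.α x) y)
  vertex : ∀ y ∈ N.darts, ∀ z ∈ N.darts, (N.σ.SameCycle y z ↔ M.σ.SameCycle y z)
  face : ∀ y ∈ N.darts, ∀ z ∈ N.darts, (N.φ.SameCycle y z ↔ M.φ.SameCycle y z ∨
      ((M.φ.SameCycle x y ∨ M.φ.SameCycle (M.α x) y) ∧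
        (M.φ.SameCycle x z ∨ M.φ.SameCycle (M.α x) z)))
  α_eq : ∀ y ∈ N.darts, M.α y ∈ N.darts → N.α y = M.α y
  α_left : P → N.α (M.α (M.σ x)) = M.α (M.σ (M.σ x))
  α_right : Q → N.α (M.α (M.σ (M.α x))) = M.α (M.σ (M.σ (M.α x)))
  σ_eq : ∀ y ∈ N.darts, M.σ y ≠ x → M.σ y ≠ M.α x → N.σ y = M.σ y
  σ_skip : ∀ y ∈ N.darts, M.σ y = x ∨ M.σ y = M.α x → N.σ y = M.σ (M.σ y)

theorem IsRemoval.symm {x : D} {P Q : Prop} {N : CombMap D} (h : IsRemoval M x P Q N) :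
    IsRemoval M (M.α x) Q P N where
  connected := h.connected
  euler := h.euler
  mem y := by
    rw [h.mem, M.α_invol]; tauto
  vertex := h.vertex
  face y hy z hz := by
    rw [h.face y hy z hz, M.α_invol]; tauto
  α_eq := h.α_eq
  α_left := h.α_right
  α_right := by rw [M.α_invol]; exact h.α_left
  σ_eq y hy h1 h2 := h.σ_eq y hy (by rwa [M.α_invol] at h2) h1
  σ_skip y hy h1 := h.σ_skip y hy (by rw [M.α_invol] at h1; exact h1.symm)

variable [DecidableEq D] [Finite D]

theorem Polyhedral.isRemoval_deleteEdge (h : Polyhedral M) {x : D} (hx : x ∈ M.darts) :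
    IsRemoval M x False False (M.deleteEdge x) where
  connected := h.deleteEdge_connected hx
  euler := h.deleteEdge_euler hx
  mem y := by rw [mem_darts_deleteEdge]; tauto
  vertex y hy z hz := by
    rw [mem_darts_deleteEdge] at hy hz
    exact M.deleteEdge_sameCycle_σ hy.2.1 hy.2.2 hz.2.1 hz.2.2
  face y hy z hz := by
    rw [mem_darts_deleteEdge] at hy hz
    exact M.deleteEdge_sameCycle_φ (h.not_sameCycle_φ_α hx) hy.2.1 hy.2.2 hz.2.1 hz.2.2
  α_eq y hy _ := by
    rw [mem_darts_deleteEdge] at hy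
    rw [deleteEdge_α, if_neg (not_or.2 hy.2)]
  α_left hF := hF.elim
  α_right hF := hF.elim
  σ_eq y hy h1 h2 := by
    rw [mem_darts_deleteEdge] at hy
    change dropPoint (dropPoint M.σ x) (M.α x) y = _
    rw [dropPoint_dropPoint_apply, if_neg (not_or.2 hy.2), if_neg h1, if_neg h2]
  σ_skip y hy h1 := by
    rw [mem_darts_deleteEdge] at hy
    change dropPoint (dropPoint M.σ x) (M.α x) y = _
    have hns := h.not_sameCycle_σ_α hx
    have h2 : M.σ x ≠ M.α x := fun hh => hns (hh ▸ sameCycle_apply_self M.σ x)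
    have h3 : M.σ (M.α x) ≠ x := fun hh => hns (by
      have := sameCycle_apply_self M.σ (M.α x)
      rw [hh] at this; exact this.symm)
    have h4 : M.α x ≠ x := hx
    rw [dropPoint_dropPoint_apply]
    grind

theorem IsRemoval.coalesce (h : Polyhedral M) {t : D} (ht : t ∈ M.darts) {Q : Prop}
    {N : CombMap D} (hN : IsRemoval M t False Q N) (h3 : M.σ (M.σ (M.σ t)) = t) :
    ∃ N', CoalesceStep N N' ∧ IsRemoval M t True Q N' := by
  set y := M.σ t with hy
  set z := M.σ y with hz
  have hns := h.not_sameCycle_σ_α ht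
  have vy : M.σ.SameCycle t y := sameCycle_apply_self _ _
  have vz : M.σ.SameCycle t z := vy.trans (sameCycle_apply_self _ _)
  have hyd := M.mem_darts_of_sameCycle_σ vy ht
  have hzd := M.mem_darts_of_sameCycle_σ vz ht
  have hyt : y ≠ t := h.σ_ne ht
  have hzt : z ≠ t := h.deg t ht
  have hzy : z ≠ y := h.σ_ne hyd
  have hin : ∀ w, M.σ.SameCycle t w → w = t ∨ w = y ∨ w = z := fun w hw =>
    sameCycle_induction (E := fun w => w = t ∨ w = y ∨ w = z) hw (Or.inl rfl) fun v _ hv => by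
      rcases hv with rfl | rfl | rfl
      · exact Or.inr (Or.inl rfl)
      · exact Or.inr (Or.inr rfl)
      · exact Or.inl h3
  have hmem : ∀ w, M.σ.SameCycle t w → w ≠ t → w ∈ N.darts := fun w hw hwt =>
    (hN.mem w).2 ⟨M.mem_darts_of_sameCycle_σ hw ht, hwt, fun hh => hns (hh ▸ hw), by simp,
      fun hh => hns (hw.trans hh.2.symm)⟩
  have hyN := hmem y vy hyt
  have hzN := hmem z vz hzt
  -- the other ends of the two edges are not at the vertex of `α t`, since there are no
  -- multiple edges
  have hαmem : ∀ w, M.σ.SameCycle t w → w ≠ t → M.α w ∈ N.darts := fun w hw hwt => by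
    have hwd := M.mem_darts_of_sameCycle_σ hw ht
    refine (hN.mem _).2 ⟨M.α_mem_darts.2 hwd, ?_, fun hh => hwt (M.α.injective hh), by simp, ?_⟩
    · intro hh
      exact h.not_sameCycle_σ_α hwd (by rw [hh]; exact hw.symm)
    · exact fun hh => hwt (h.simple ht hwd hw hh.2).symm
  have hαy : N.α y = M.α y := hN.α_eq y hyN (hαmem y vy hyt)
  have hαz : N.α z = M.α z := hN.α_eq z hzN (hαmem z vz hzt)
  have hσy : N.σ y = z := hN.σ_eq y hyN hzt (fun hh => hns (hh ▸ vz))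
  have hσz : N.σ z = y := by rw [hN.σ_skip z hzN (Or.inl h3), h3]
  have hne : N.α y ≠ z := by
    rw [hαy]
    exact fun hh => h.not_sameCycle_σ_α hyd (by rw [hh]; exact vy.symm.trans vz)
  have hd : ∀ w, w ∈ (N.fuse y z hyN hzN hzy.symm).darts ↔ w ∈ N.darts ∧ w ≠ y ∧ w ≠ z :=
    fun w => mem_darts_fuse hyN hzN hzy.symm
  refine ⟨N.fuse y z hyN hzN hzy.symm, ⟨y, z, hyN, hzN, hzy.symm, hσy, hσz, hne, rfl⟩, ?_⟩
  refine ⟨fuse_connected _ _ _ hσy hσz hne hN.connected, fuse_euler _ _ _ hσy hσz hne hN.euler,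
    ?_, ?_, ?_, ?_, ?_, ?_, ?_, ?_⟩
  · intro w
    rw [hd, hN.mem]
    constructor
    · rintro ⟨⟨h4, h5, h6, -, h7⟩, h8, h9⟩
      exact ⟨h4, h5, h6, fun hh => by rcases hin w hh.2 with hw | hw | hw <;> contradiction, h7⟩
    · rintro ⟨h4, h5, h6, h7, h8⟩
      refine ⟨⟨h4, h5, h6, by simp, h8⟩, ?_, ?_⟩
      · rintro rfl; exact h7 ⟨trivial, vy⟩
      · rintro rfl; exact h7 ⟨trivial, vz⟩
  · intro a ha b hb
    rw [hd] at ha hb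
    rw [fuse_sameCycle_σ hyN hzN hzy.symm ha.2.1 ha.2.2 hb.2.1 hb.2.2, hN.vertex a ha.1 b hb.1]
  · intro a ha b hb
    rw [hd] at ha hb
    rw [fuse_sameCycle_φ hyN hzN hzy.symm hσy hσz ha.2.1 ha.2.2 hb.2.1 hb.2.2,
      hN.face a ha.1 b hb.1]
  · intro a ha hαa
    rw [hd] at ha hαa
    have i := M.α_invol
    rw [fuse_α, if_neg (not_or.2 ha.2), if_neg, if_neg, hN.α_eq a ha.1 hαa.1]
    · rw [hαz]; rintro rfl; exact hαa.2.2 (i z)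
    · rw [hαy]; rintro rfl; exact hαa.2.1 (i y)
  · intro _
    have h4 := (hd (M.α y)).2 ⟨hαmem y vy hyt,
      fun hh => h.not_sameCycle_σ_α hyd (by rw [hh]),
      fun hh => hne (hαy.trans hh)⟩
    rw [hd] at h4
    rw [fuse_α, if_neg (not_or.2 h4.2), if_pos hαy.symm, hαz]
  · intro hQ
    have vu := sameCycle_apply_self M.σ (M.α t)
    have hud := M.α_mem_darts.2 ht
    have hu := M.mem_darts_of_sameCycle_σ vu hud
    have hw : ¬ M.σ.SameCycle t (M.α (M.σ (M.α t))) := fun hh => by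
      have := h.simple ht (M.α_mem_darts.2 hu) hh (by rw [M.α_invol]; exact vu)
      exact h.σ_ne hud (by nth_rw 2 [this]; rw [M.α_invol])
    have hw' : ∀ w, M.σ.SameCycle t w → M.α (M.σ (M.α t)) ≠ M.α w := fun w hw hh =>
      hns (hw.trans (by rw [← M.α.injective hh]; exact vu.symm))
    rw [fuse_α, if_neg, if_neg, if_neg, hN.α_right hQ]
    · rw [hαz]; exact hw' z vz
    · rw [hαy]; exact hw' y vy
    · rintro (hh | hh)
      · exact hw (by rw [hh]; exact vy)
      · exact hw (by rw [hh]; exact vz)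
  · intro a ha h4 h5
    rw [hd] at ha
    rw [fuse_σ _ _ _ hσy hσz, if_neg (not_or.2 ha.2), hN.σ_eq a ha.1 h4 h5]
  · intro a ha h4
    rw [hd] at ha
    rw [fuse_σ _ _ _ hσy hσz, if_neg (not_or.2 ha.2), hN.σ_skip a ha.1 h4]

theorem Polyhedral.exists_isRemoval (h : Polyhedral M) {x : D} (hx : x ∈ M.darts) :
    ∃ N, Relation.ReflTransGen CoalesceStep (M.deleteEdge x) N ∧
      IsRemoval M x (M.σ (M.σ (M.σ x)) = x) (M.σ (M.σ (M.σ (M.α x))) = M.α x) N := by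
  have h1 : ∃ N, Relation.ReflTransGen CoalesceStep (M.deleteEdge x) N ∧
      IsRemoval M x (M.σ (M.σ (M.σ x)) = x) False N := by
    by_cases h3 : M.σ (M.σ (M.σ x)) = x
    · obtain ⟨N, hN, hN'⟩ := (h.isRemoval_deleteEdge hx).coalesce h hx h3
      exact ⟨N, .single hN, by simpa only [h3] using hN'⟩
    · exact ⟨_, .refl, by simpa only [h3] using h.isRemoval_deleteEdge hx⟩
  obtain ⟨N, hN, hN'⟩ := h1
  by_cases h3 : M.σ (M.σ (M.σ (M.α x))) = M.α x
  · obtain ⟨N', hN1, hN2⟩ := hN'.symm.coalesce h (M.α_mem_darts.2 hx) h3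
    have hN3 := hN2.symm
    rw [M.α_invol] at hN3
    exact ⟨N', hN.tail hN1, by simpa only [h3] using hN3⟩
  · exact ⟨N, hN, by simpa only [h3] using hN'⟩

end
end CombMap

namespace CombMap

section

variable {D : Type*} {M : CombMap D}

/-- A third face, away from the ends of the edge of `x`, meets both faces at this edge. The darts
`p`, `q` start at a common vertex with the face of `x`, the darts `r`, `s` at a common vertex
with the face of `α x`, and `q`, `s` lie on the third face. -/
def Blocked (M : CombMap D) (x : D) : Prop :=
  ∃ p q s r, M.φ.SameCycle x p ∧ M.σ.SameCycle p q ∧ M.φ.SameCycle q s ∧ M.σ.SameCycle s r ∧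
    M.φ.SameCycle r (M.α x) ∧
    ∀ y, M.φ.SameCycle y q → ¬ M.σ.SameCycle y x ∧ ¬ M.σ.SameCycle y (M.α x)

/-- After the removal of an edge, a dart on either face at the edge has no counterpart at the same
vertex on the other face. -/
theorem IsRemoval.not_cross (h : Polyhedral M) {x : D} (hx : x ∈ M.darts) {P Q : Prop}
    {N : CombMap D} (hN : IsRemoval M x P Q N) {y z : D} (hy : y ∈ N.darts) (hz : z ∈ N.darts)
    (h1 : M.φ.SameCycle x y) (h2 : M.φ.SameCycle (M.α x) z) : ¬ M.σ.SameCycle y z := by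
  intro h3
  rw [hN.mem] at hy hz
  rcases h.meet x (M.σ⁻¹ x) z y (M.sameCycle_σ_inv x) ((M.sameCycle_φ_σ_inv x).symm.trans h2)
    h3.symm h1.symm with hm | hm | hm | hm
  · exact hy.2.1 hm.symm
  · exact h.σ_ne hx (by nth_rw 1 [hm]; simp)
  · exact hz.2.2.1 hm.symm
  · have h4 : M.φ y = M.σ⁻¹ (M.σ⁻¹ x) := by rw [← hm, M.φ_apply, M.α_invol]
    have h5 := h.cell (M.φ y) x ((sameCycle_apply_self M.φ y).symm.trans h1.symm) (by
      rw [h4]; exact ((M.sameCycle_σ_inv x).trans (M.sameCycle_σ_inv _)).symm)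
    refine h.deg x hx ?_
    nth_rw 1 [← h5]
    rw [h4]; simp

/-- The main case of the condition `meet` for the map `N` obtained by removing an edge: a third
face, of `q` and `s`, meets both faces at the removed edge. If it goes through the initial vertex
of `x`, then this vertex is 3-valent and has been coalesced. -/
theorem IsRemoval.meet_of_sameCycle (h : Polyhedral M) {x : D} (hx : x ∈ M.darts) {Q : Prop}
    {N : CombMap D} (hN : IsRemoval M x (M.σ (M.σ (M.σ x)) = x) Q N) {p q s r y : D}
    (hp : p ∈ N.darts) (hq : q ∈ N.darts) (hs : s ∈ N.darts)
    (h0 : M.φ.SameCycle x p) (h1 : M.σ.SameCycle p q) (h2 : M.φ.SameCycle q s)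
    (h3 : M.σ.SameCycle s r) (h4 : M.φ.SameCycle r (M.α x))
    (hq1 : ¬ M.φ.SameCycle x q) (hq2 : ¬ M.φ.SameCycle (M.α x) q)
    (h5 : M.φ.SameCycle y q) (h6 : M.σ.SameCycle y x) : N.α p = s := by
  have hp' := (hN.mem p).1 hp
  have hq' := (hN.mem q).1 hq
  have hxf := h.not_sameCycle_φ_α hx
  rcases h.meet x y q p h6.symm h5 h1.symm h0.symm with hm | hm | hm | hm
  · exact absurd hm.symm hp'.2.1
  · exact absurd (by rwa [hm]) hq1
  · exact absurd hm.symm hq'.2.2.1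
  have hαp : M.α p = y := by rw [← hm, M.α_invol]
  have h7 := M.sameCycle_σ_inv x
  have h8 := M.sameCycle_φ_σ_inv x
  rcases h.meet (M.σ⁻¹ x) y s r (h7.symm.trans h6.symm) (h5.trans h2) h3 (h4.trans h8)
    with hm' | hm' | hm' | hm'
  · have : s = y := h.cell s y (h5.trans h2).symm
      (h3.trans (by rw [← hm']; exact (h6.trans h7).symm))
    rw [this] at hs ⊢
    rw [← hαp] at hs ⊢
    exact hN.α_eq p hp hs
  · exact absurd (h8.trans (by rw [hm']; exact h5)) hq2
  · have e1 : y = M.σ x := by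
      have h9 : M.φ p = M.σ⁻¹ y := by rw [M.φ_apply, hαp]
      have h10 := h.cell (M.φ p) x ((sameCycle_apply_self M.φ p).symm.trans h0.symm)
        (by rw [h9]; exact (M.sameCycle_σ_inv y).symm.trans h6)
      rw [← h10, h9]; simp
    have e2 : M.σ⁻¹ (M.σ⁻¹ x) = y := by
      have h9 : M.φ s = M.σ⁻¹ (M.σ⁻¹ x) := by rw [M.φ_apply, ← hm', M.α_invol]
      have h10 := h.cell (M.φ s) y ((sameCycle_apply_self M.φ s).symm.trans (h5.trans h2).symm)
        (by rw [h9]; exact (h7.trans (M.sameCycle_σ_inv _)).symm.trans h6.symm)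
      rw [← h9, h10]
    have e3 : M.σ (M.σ (M.σ x)) = x := by rw [← e1, ← e2]; simp
    have e4 : M.σ (M.σ x) = M.σ⁻¹ x := by rw [Perm.eq_inv_iff_eq, e3]
    have := hN.α_left e3
    rwa [← e1, hm, e1, e4, hm'] at this
  · rw [hm] at hm'
    subst hm'
    exact absurd (h0.trans h4) hxf

theorem IsRemoval.prePolyhedral [Finite D] (h : Polyhedral M) {x : D} (hx : x ∈ M.darts)
    (hb : ¬ M.Blocked x) {N : CombMap D}
    (hN : IsRemoval M x (M.σ (M.σ (M.σ x)) = x) (M.σ (M.σ (M.σ (M.α x))) = M.α x) N) :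
    PrePolyhedral N := by
  have hx' := M.α_mem_darts.2 hx
  have hns := h.not_sameCycle_σ_α hx
  have hnf := h.not_sameCycle_φ_α hx
  have hcell : ∀ y z, N.φ.SameCycle y z → N.σ.SameCycle y z → y = z := by
    intro y z h1 h2
    by_cases hy : y ∈ N.darts
    swap
    · exact h2.eq_of_left (N.σ_eq_self_of_notMem hy)
    have hz := N.mem_darts_of_sameCycle_σ h2 hy
    rw [hN.vertex y hy z hz] at h2
    rw [hN.face y hy z hz] at h1
    rcases h1 with h1 | ⟨h3 | h3, h4 | h4⟩
    · exact h.cell y z h1 h2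
    · exact h.cell y z (h3.symm.trans h4) h2
    · exact absurd h2 (hN.not_cross h hx hy hz h3 h4)
    · exact absurd h2.symm (hN.not_cross h hx hz hy h4 h3)
    · exact h.cell y z (h3.symm.trans h4) h2
  have hmeet : ∀ x, x ∈ M.darts → ¬ M.φ.SameCycle x (M.α x) →
      ¬ M.Blocked x → IsRemoval M x (M.σ (M.σ (M.σ x)) = x)
        (M.σ (M.σ (M.σ (M.α x))) = M.α x) N → ∀ p q s r,
      p ∈ N.darts → q ∈ N.darts → s ∈ N.darts → r ∈ N.darts →
      M.σ.SameCycle p q → M.φ.SameCycle q s → M.σ.SameCycle s r → M.φ.SameCycle x p →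
      M.φ.SameCycle r (M.α x) → p = q ∨ N.α p = s ∨ N.α q = r := by
    intro x hx hnf hb hN p q s r hp hq hs hr h1 h2 h3 h4 h5
    by_cases hq0 : M.φ.SameCycle x q ∨ M.φ.SameCycle (M.α x) q
    · exact Or.inl (hcell p q ((hN.face p hp q hq).2 (Or.inr ⟨Or.inl h4, hq0⟩))
        ((hN.vertex p hp q hq).2 h1))
    obtain ⟨hq1, hq2⟩ := not_or.1 hq0
    obtain ⟨y, hy, hy'⟩ : ∃ y, M.φ.SameCycle y q ∧
        (M.σ.SameCycle y x ∨ M.σ.SameCycle y (M.α x)) := by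
      by_contra hcon
      push Not at hcon
      exact hb ⟨p, q, s, r, h4, h1, h2, h3, h5, hcon⟩
    rcases hy' with hy' | hy'
    · exact Or.inr (Or.inl
        (hN.meet_of_sameCycle h hx hp hq hs h4 h1 h2 h3 h5 hq1 hq2 hy hy'))
    · right; right
      have := hN.symm.meet_of_sameCycle h (M.α_mem_darts.2 hx) hr hs hq h5.symm h3.symm h2.symm
        h1.symm (by rw [M.α_invol]; exact h4.symm) (fun hh => hq2 (hh.trans h2.symm))
        (by rw [M.α_invol]; exact fun hh => hq1 (hh.trans h2.symm)) (hy.trans h2) hy'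
      rw [← this, N.α_invol]
  have hb' : ¬ M.Blocked (M.α x) := by
    rintro ⟨p, q, s, r, h1, h2, h3, h4, h5, h6⟩
    rw [M.α_invol] at h5 h6
    exact hb ⟨r, s, q, p, h5.symm, h4.symm, h3.symm, h2.symm, h1.symm,
      fun y hy => (h6 y (hy.trans h3.symm)).symm⟩
  have hnf' : ¬ M.φ.SameCycle (M.α x) (M.α (M.α x)) := by
    rw [M.α_invol]; exact fun hh => hnf hh.symm
  have hN' : IsRemoval M (M.α x) (M.σ (M.σ (M.σ (M.α x))) = M.α x)
      (M.σ (M.σ (M.σ (M.α (M.α x)))) = M.α (M.α x)) N := by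
    rw [M.α_invol]; exact hN.symm
  refine ⟨?_, hN.connected, hN.euler, hcell, ?_, ?_⟩
  · by_cases h3 : M.σ (M.σ (M.σ x)) = x
    · have h1 := sameCycle_apply_self M.σ x
      have hd := M.σ_mem_darts hx
      have h2 : ¬ M.σ.SameCycle (M.α x) (M.α (M.σ x)) := fun hh =>
        h.σ_ne hx (h.simple hx hd h1 hh).symm
      have h4 : ¬ M.σ.SameCycle x (M.α (M.σ x)) := fun hh =>
        h.not_sameCycle_σ_α hd (h1.symm.trans hh)
      refine ⟨M.α (M.σ x), (hN.mem _).2 ⟨M.α_mem_darts.2 hd, ?_, ?_, fun hh => h4 hh.2,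
        fun hh => h2 hh.2⟩⟩
      · exact fun hh => h4 (by rw [hh])
      · exact fun hh => h2 (by rw [hh])
    · have h1 := sameCycle_apply_self M.σ x
      exact ⟨M.σ x, (hN.mem _).2 ⟨M.σ_mem_darts hx, h.σ_ne hx, fun hh => hns (hh ▸ h1),
        fun hh => h3 hh.1, fun hh => hns (h1.trans hh.2.symm)⟩⟩
  · intro y hy hyy
    -- the vertex of `y` in `N` would have at most two darts
    have hin : ∀ z ∈ N.darts, M.σ.SameCycle y z → z = y ∨ z = N.σ y := fun z hz hyz =>
      sameCycle_induction (E := fun z => z = y ∨ z = N.σ y) ((hN.vertex y hy z hz).2 hyz)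
        (Or.inl rfl) fun v _ hv => by
          rcases hv with rfl | rfl
          · exact Or.inr rfl
          · exact Or.inl hyy
    have hthree : ∀ a b c, a ∈ N.darts → b ∈ N.darts → c ∈ N.darts → M.σ.SameCycle y a →
        M.σ.SameCycle y b → M.σ.SameCycle y c → a ≠ b → a ≠ c → b ≠ c → False := by
      intro a b c ha hb hc ha' hb' hc' h1 h2 h3
      have := hin a ha ha'
      have := hin b hb hb'
      have := hin c hc hc'
      grind
    have hy' := (hN.mem y).1 hy
    have hcase : ∀ x, x ∈ M.darts → (∀ y, y ∈ N.darts ↔ y ∈ M.darts ∧ y ≠ x ∧ y ≠ M.α x ∧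
        ¬ (M.σ (M.σ (M.σ x)) = x ∧ M.σ.SameCycle x y) ∧
        ¬ (M.σ (M.σ (M.σ (M.α x))) = M.α x ∧ M.σ.SameCycle (M.α x) y)) →
        ¬ M.σ.SameCycle x y := by
      intro x hx hmem hxy
      have hns := h.not_sameCycle_σ_α hx
      have hP : M.σ (M.σ (M.σ x)) ≠ x := fun hh => ((hmem y).1 hy).2.2.2.1 ⟨hh, hxy⟩
      have hm : ∀ z, M.σ.SameCycle x z → z ≠ x → z ∈ N.darts := fun z hz hzx =>
        (hmem z).2 ⟨M.mem_darts_of_sameCycle_σ hz hx, hzx, fun hh => hns (hh ▸ hz),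
          fun hh => hP hh.1, fun hh => hns (hz.trans hh.2.symm)⟩
      have v1 := sameCycle_apply_self M.σ x
      have v2 := v1.trans (sameCycle_apply_self M.σ _)
      have v3 := v2.trans (sameCycle_apply_self M.σ _)
      have d1 := M.mem_darts_of_sameCycle_σ v1 hx
      exact hthree _ _ _ (hm _ v1 (h.σ_ne hx)) (hm _ v2 (h.deg x hx)) (hm _ v3 hP)
        (hxy.symm.trans v1) (hxy.symm.trans v2) (hxy.symm.trans v3) (h.σ_ne d1).symm
        (h.deg _ d1).symm (h.σ_ne (M.mem_darts_of_sameCycle_σ v2 hx)).symm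
    have hxy := hcase x hx hN.mem
    have hxy' := hcase (M.α x) hx' hN'.mem
    have hm : ∀ z, M.σ.SameCycle y z → z ∈ N.darts := fun z hz =>
      (hN.mem z).2 ⟨M.mem_darts_of_sameCycle_σ hz hy'.1, fun hh => hxy (hh ▸ hz.symm),
        fun hh => hxy' (hh ▸ hz.symm), fun hh => hxy (hh.2.trans hz.symm),
        fun hh => hxy' (hh.2.trans hz.symm)⟩
    have v1 := sameCycle_apply_self M.σ y
    have v2 := v1.trans (sameCycle_apply_self M.σ _)
    exact hthree _ _ _ hy (hm _ v1) (hm _ v2) .rfl v1 v2 (h.σ_ne hy'.1).symm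
      (h.deg y hy'.1).symm (h.σ_ne (M.mem_darts_of_sameCycle_σ v1 hy'.1)).symm
  · have hface : ∀ y ∈ N.darts, ∀ z ∈ N.darts, N.φ.SameCycle y z → M.φ.SameCycle y z ∨
        (M.φ.SameCycle x y ∧ M.φ.SameCycle (M.α x) z) ∨
        (M.φ.SameCycle (M.α x) y ∧ M.φ.SameCycle x z) := by
      intro y hy z hz h1
      rcases (hN.face y hy z hz).1 h1 with h1 | ⟨h2 | h2, h3 | h3⟩
      · exact Or.inl h1
      · exact Or.inl (h2.symm.trans h3)
      · exact Or.inr (Or.inl ⟨h2, h3⟩)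
      · exact Or.inr (Or.inr ⟨h2, h3⟩)
      · exact Or.inl (h2.symm.trans h3)
    have hmixed : ∀ p ∈ N.darts, ∀ q ∈ N.darts, ∀ s ∈ N.darts, ∀ r ∈ N.darts,
        M.σ.SameCycle p q → M.φ.SameCycle q s → M.σ.SameCycle s r → N.φ.SameCycle r p →
        p = r ∨ p = q ∨ N.α p = s ∨ N.α q = r := by
      intro p hp q hq s hs r hr h1 h2 h3 h4
      rcases hface r hr p hp h4 with h4 | ⟨h4, h5⟩ | ⟨h4, h5⟩
      · rcases h.meet p q s r h1 h2 h3 h4 with hm | hm | hm | hm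
        · exact Or.inl hm
        · exact Or.inr (Or.inl hm)
        · exact Or.inr (Or.inr (Or.inl (by rw [hN.α_eq p hp (by rwa [hm]), hm])))
        · exact Or.inr (Or.inr (Or.inr (by rw [hN.α_eq q hq (by rwa [hm]), hm])))
      · exact Or.inr (hmeet _ hx' hnf' hb' hN' p q s r hp hq hs hr h1 h2 h3 h5
          (by rw [M.α_invol]; exact h4.symm))
      · exact Or.inr (hmeet _ hx hnf hb hN p q s r hp hq hs hr h1 h2 h3 h5 h4.symm)
    intro p q s r h1 h2 h3 h4
    by_cases hp : p ∈ N.darts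
    swap
    · exact Or.inr (Or.inl (h1.eq_of_left (N.σ_eq_self_of_notMem hp)))
    have hq := N.mem_darts_of_sameCycle_σ h1 hp
    have hs := N.mem_darts_of_sameCycle_φ h2 hq
    have hr := N.mem_darts_of_sameCycle_σ h3 hs
    have g1 := (hN.vertex p hp q hq).1 h1
    have g3 := (hN.vertex s hs r hr).1 h3
    rcases hface q hq s hs h2 with g2 | g2
    · exact hmixed p hp q hq s hs r hr g1 g2 g3 h4
    rcases hface r hr p hp h4 with g4 | g4
    · rcases hmixed q hq p hp r hr s hs g1.symm g4.symm g3.symm h2.symm with hm | hm | hm | hm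
      · rw [hm] at h1
        exact Or.inl (hcell p r h4.symm (h1.trans h3))
      · exact Or.inr (Or.inl hm.symm)
      · exact Or.inr (Or.inr (Or.inr hm))
      · exact Or.inr (Or.inr (Or.inl hm))
    · refine Or.inr (Or.inl (hcell p q ((hN.face p hp q hq).2 (Or.inr ⟨?_, ?_⟩)) h1)) <;> tauto

/-! ### The two operations -/

theorem Polyhedral.removable [Finite D] [DecidableEq D] (h : Polyhedral M) {x : D}
    (hx : x ∈ M.darts) (hb : ¬ M.Blocked x) : M.Removable x := by
  obtain ⟨N, h1, h2⟩ := h.exists_isRemoval hx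
  exact ⟨N, h1, (h2.prePolyhedral h hx hb).polyhedral.isTPM⟩

/-- Contracting an edge is deleting it in the dual map. -/
theorem Polyhedral.shrinkable [Finite D] [DecidableEq D] (h : Polyhedral M) {x : D}
    (hx : x ∈ M.darts) (hb : ¬ M.dual.Blocked x) : M.Shrinkable x := by
  obtain ⟨N, h1, h2⟩ := h.dual.exists_isRemoval hx
  refine ⟨N.dual, ?_, (h2.prePolyhedral h.dual hx hb).polyhedral.dual.isTPM⟩
  rw [contractEdge_eq_dual]
  refine h1.lift CombMap.dual ?_
  intro _ _ hs
  exact hs.dual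

end
end CombMap

namespace CombMap

section

/-! ### Homotopic walks are homologous -/

variable {D : Type*} [DecidableEq D] {M : CombMap D}

/-- Along a segment of an orbit, the number of visits changes only at the two ends. -/
theorem count_iterate_apply (π : Perm D) (p y : D) (m : ℕ) :
    ((List.iterate π p m).count (π y) : ℤ) + (if (π ^ m) p = π y then 1 else 0) =
      (List.iterate π p m).count y + (if p = π y then 1 else 0) := by
  induction m generalizing p with
  | zero => simp
  | succ m ih =>
    have h1 := ih (π p)
    have h2 : (π ^ m) (π p) = (π ^ (m + 1)) p := by rw [pow_succ, Perm.mul_apply]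
    rw [h2] at h1
    simp only [List.iterate, List.count_cons, beq_iff_eq]
    have h3 : π p = π y ↔ p = y := π.injective.eq_iff
    simp only [h3] at h1
    simp only [Nat.cast_add, Nat.cast_ite, Nat.cast_one, Nat.cast_zero]
    linarith

theorem count_iterate_of_not_sameCycle (π : Perm D) {p y : D} (h : ¬ π.SameCycle p y) (m : ℕ) :
    (List.iterate π p m).count y = 0 := by
  rw [List.count_eq_zero, List.mem_iterate]
  rintro ⟨k, -, rfl⟩
  exact h ⟨k, by simp [Perm.iterate_eq_pow]⟩

/-- The walks `Γ` and `Γ'` are homologous: their difference is the boundary of a combination of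
faces. The number of signed traversals of each dart by `Γ`, minus that by `Γ'`, is the difference
of the multiplicities `S` of the faces on its left and on its right. -/
def Homologous (M : CombMap D) (Γ Γ' : List D) : Prop :=
  ∃ S : D → ℤ, (∀ y, S (M.φ y) = S y) ∧
    ∀ y, ((Γ.count y : ℤ) - Γ.count (M.α y)) - (Γ'.count y - Γ'.count (M.α y)) = S y - S (M.α y)

/-- A walk once around a face traverses the darts of each face equally often. -/
theorem count_faceWalk [Finite D] (x : D) : ∃ S : D → ℤ, (∀ y, S (M.φ y) = S y) ∧
    ∀ y, (M.faceWalk x).count y = S y := by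
  refine ⟨fun y => (M.faceWalk x).count y, fun y => ?_, fun _ => rfl⟩
  have h := count_iterate_apply M.φ x y (M.face x).ncard
  have h2 : (M.φ ^ (M.face x).ncard) x = x := by
    have hc : M.φ.IsCycleOn ((Set.toFinite (M.face x)).toFinset : Set D) := by
      rw [Set.Finite.coe_toFinset]
      refine ⟨⟨fun y hy => Perm.sameCycle_apply_right.2 hy, M.φ.injective.injOn, fun y hy => ?_⟩,
        fun y hy z hz => Perm.SameCycle.trans (Perm.SameCycle.symm hy) hz⟩
      refine ⟨M.φ⁻¹ y, ?_, by simp⟩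
      change M.φ.SameCycle x (M.φ⁻¹ y)
      refine Perm.SameCycle.trans hy ?_
      simpa using (sameCycle_apply_self M.φ (M.φ⁻¹ y)).symm
    rw [Set.ncard_eq_toFinset_card _ (Set.toFinite _)]
    exact hc.pow_card_apply ((Set.Finite.mem_toFinset _).2 (Perm.SameCycle.refl M.φ x))
  rw [h2] at h
  exact add_right_cancel h

theorem Homotopic.homologous [Finite D] {R u : Set D} {Γ Γ' : List D} (h : M.Homotopic R u Γ Γ') :
    Homologous M Γ Γ' := by
  induction h with
  | rel p q h =>
    obtain ⟨-, -, h⟩ := h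
    cases h with
    | spur p q x =>
      refine ⟨0, by simp, fun y => ?_⟩
      have h1 := M.α_invol
      have h2 : (M.α x = M.α y) = (x = y) := by simp
      have h3 : (M.α x = y) = (x = M.α y) := by
        rw [eq_iff_iff]; constructor
        · rintro rfl; rw [h1]
        · rintro rfl; rw [h1]
      simp only [List.count_append, List.count_cons, List.count_nil, beq_iff_eq, h2, h3]
      push_cast
      simp only [Pi.zero_apply]
      ring
    | face p q x hx =>
      obtain ⟨S, h1, h2⟩ := M.count_faceWalk x
      refine ⟨S, h1, fun y => ?_⟩
      simp only [List.count_append]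
      push_cast
      rw [h2, h2]
      ring
  | refl p => exact ⟨0, by simp, fun y => by simp⟩
  | symm p q _ ih =>
    obtain ⟨S, h1, h2⟩ := ih
    refine ⟨-S, fun y => by simp [h1], fun y => ?_⟩
    have := h2 y
    simp only [Pi.neg_apply]
    linarith
  | trans p q r _ _ ih1 ih2 =>
    obtain ⟨S, h1, h2⟩ := ih1
    obtain ⟨T, h3, h4⟩ := ih2
    refine ⟨S + T, fun y => by simp [h1, h3], fun y => ?_⟩
    have := h2 y
    have := h4 y
    simp only [Pi.add_apply]
    linarith

end
end CombMap

namespace CombMap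

section

variable {D : Type*} {M : CombMap D}

/-! ### An edge inside a simply connected region -/

theorem IsWalkIn.append {R : Set D} {u v w : Set D} {p q : List D} (h1 : M.IsWalkIn R u v p)
    (h2 : M.IsWalkIn R v w q) : M.IsWalkIn R u w (p ++ q) := by
  induction p generalizing u with
  | nil => rw [show u = v from h1]; exact h2
  | cons x p ih => exact ⟨h1.1, h1.2.1, ih h1.2.2⟩

theorem isWalkIn_iterate {R : Set D} (hR : ∀ y ∈ R, M.φ y ∈ R) (m : ℕ) {p : D} (hp : p ∈ R) :
    M.IsWalkIn R (M.vertex p) (M.vertex ((M.φ ^ m) p)) (List.iterate M.φ p m) := by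
  induction m generalizing p with
  | zero => rfl
  | succ m ih =>
    have h := ih (hR p hp)
    rw [← Perm.mul_apply, ← pow_succ] at h
    refine ⟨Or.inl hp, rfl, ?_⟩
    rwa [← M.vertex_eq_iff.2 (M.sameCycle_σ_φ p)]

/-- If the edge of `x` is blocked both in the map and in its dual, then a closed walk through this
edge and two further faces is crossed exactly once by a closed curve through the two faces at the
edge and a third face. So the walk does not bound, and is not null-homotopic. -/
theorem not_blocked_of_region [Finite D] {x : D} (hx : x ∈ M.darts) {R : Set D}
    (hRφ : ∀ y ∈ R, M.φ y ∈ R) (hu : ∀ y, M.σ.SameCycle x y → y ∈ R)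
    (hv : ∀ y, M.σ.SameCycle (M.α x) y → y ∈ R)
    (htriv : ∀ Γ, M.IsWalkIn R (M.vertex x) (M.vertex x) Γ → M.Homotopic R (M.vertex x) Γ [])
    (hb : M.Blocked x) (hb' : M.dual.Blocked x) : False := by
  classical
  obtain ⟨p, q, s, r, f1, v1, f2, v2, f3, hq⟩ := hb
  obtain ⟨k, w, w', l, v3, f4, v4, f5, v5, hw⟩ := hb'
  simp only [dual_sameCycle_σ, dual_sameCycle_φ, dual_α] at v3 f4 v4 f5 v5 hw
  have hRF : ∀ y z, M.φ.SameCycle y z → y ∈ R → z ∈ R := fun y z h hy =>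
    sameCycle_induction h hy fun t _ ht => hRφ t ht
  have hk : k ∈ R := hu k v3
  have hw' : w' ∈ R := hRF l w' f5.symm (hv l v5.symm)
  obtain ⟨m, hm⟩ := f4.exists_nat_pow_eq
  obtain ⟨n, hn⟩ := f5.exists_nat_pow_eq
  set A := List.iterate M.φ k m with hA
  set B := List.iterate M.φ w' n with hB
  have hwalk : M.IsWalkIn R (M.vertex x) (M.vertex x) (A ++ B ++ [M.α x]) := by
    have hA' := isWalkIn_iterate hRφ m hk
    have hB' := isWalkIn_iterate hRφ n hw'
    rw [hm, ← M.vertex_eq_iff.2 v3, M.vertex_eq_iff.2 v4] at hA'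
    rw [hn, M.vertex_eq_iff.2 v5] at hB'
    refine (hA'.append hB').append ⟨Or.inl (hv _ .rfl), rfl, ?_⟩
    rw [M.α_invol]; rfl
  obtain ⟨S, hS, hΓ⟩ := (htriv _ hwalk).homologous
  simp only [List.count_append, List.count_cons, List.count_nil, beq_iff_eq] at hΓ
  push_cast at hΓ
  have hSF : ∀ y z, M.φ.SameCycle y z → S y = S z := fun y z h =>
    sameCycle_induction (E := fun z => S y = S z) h rfl fun t _ ht => by rw [hS, ht]
  -- away from the ends of the two arcs, the multiplicity of a corner, corrected by the arcs
  -- running along its face, is constant around a vertex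
  have hconst : ∀ y z, M.σ.SameCycle y z → ¬ M.σ.SameCycle y x → ¬ M.σ.SameCycle y (M.α x) →
      ¬ M.σ.SameCycle y w → S y - A.count y - B.count y = S z - A.count z - B.count z := by
    intro y z hyz h1 h2 h3
    refine sameCycle_induction
      (E := fun z => S y - A.count y - B.count y = S z - A.count z - B.count z) hyz rfl
      fun t hyt ht => ?_
    have e1 : M.φ (M.α (M.σ t)) = t := M.φ_α_σ t
    have e2 := hS (M.α (M.σ t))
    have e3 := count_iterate_apply M.φ k (M.α (M.σ t)) m
    have e4 := count_iterate_apply M.φ w' (M.α (M.σ t)) n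
    have e5 := hΓ (M.σ t)
    rw [e1] at e2 e3 e4
    rw [hm, if_neg (fun hh => h3 (by rw [hh]; exact hyt)),
      if_neg (fun hh => h1 (by rw [← hh] at hyt; exact hyt.trans v3.symm))] at e3
    rw [hn, if_neg (fun hh => h2 (by rw [← hh] at hyt; exact hyt.trans v5)),
      if_neg (fun hh => h3 (by rw [← hh] at hyt; exact hyt.trans v4.symm))] at e4
    have hyt' : M.σ.SameCycle y (M.σ t) := Perm.sameCycle_apply_right.2 hyt
    rw [if_neg (fun hh => h2 (by rw [hh]; exact hyt')),
      if_neg (fun hh => h1 (by rw [M.α.injective hh]; exact hyt'))] at e5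
    simp only [← hA, ← hB] at e3 e4
    linarith
  have hA0 : ∀ y, ¬ M.φ.SameCycle k y → A.count y = 0 := fun y hy =>
    count_iterate_of_not_sameCycle M.φ hy m
  have hB0 : ∀ y, ¬ M.φ.SameCycle w' y → B.count y = 0 := fun y hy =>
    count_iterate_of_not_sameCycle M.φ hy n
  have hkx : ∀ y, M.φ.SameCycle x y → A.count y = 0 := fun y hy =>
    hA0 y fun hh => (hw w .rfl).1 (f4.symm.trans (hh.trans hy.symm))
  have hkx' : ∀ y, M.φ.SameCycle (M.α x) y → A.count y = 0 := fun y hy =>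
    hA0 y fun hh => (hw w .rfl).2 (f4.symm.trans (hh.trans hy.symm))
  have hlx : ∀ y, M.φ.SameCycle x y → B.count y = 0 := fun y hy =>
    hB0 y fun hh => (hw w' v4.symm).1 (hh.trans hy.symm)
  have hlx' : ∀ y, M.φ.SameCycle (M.α x) y → B.count y = 0 := fun y hy =>
    hB0 y fun hh => (hw w' v4.symm).2 (hh.trans hy.symm)
  have hkq : ∀ y, M.φ.SameCycle q y → A.count y = 0 := fun y hy =>
    hA0 y fun hh => (hq k (hh.trans hy.symm)).1 v3.symm
  have hlq : ∀ y, M.φ.SameCycle q y → B.count y = 0 := fun y hy =>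
    hB0 y fun hh => (hq l (f5.symm.trans (hh.trans hy.symm))).2 v5
  have g1 := hconst p q v1 (fun hh => (hq q .rfl).1 (v1.symm.trans hh))
    (fun hh => (hq q .rfl).2 (v1.symm.trans hh)) (fun hh => (hw p hh).1 f1.symm)
  have g2 := hconst s r v2 (hq s f2.symm).1 (hq s f2.symm).2
    (fun hh => (hw r (v2.symm.trans hh)).2 f3)
  rw [hkx p f1, hlx p f1, hkq q .rfl, hlq q .rfl] at g1
  rw [hkx' r f3.symm, hlx' r f3.symm, hkq s f2, hlq s f2] at g2
  have g3 := hΓ x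
  rw [hkx x .rfl, hlx x .rfl, hkx' _ .rfl, hlx' _ .rfl, if_neg hx] at g3
  have g4 := hSF _ _ f1
  have g5 := hSF _ _ f2
  have g6 := hSF _ _ f3
  simp at g1 g2 g3
  linarith

end
end CombMap

theorem lemma8 {D : Type*} [Finite D] [DecidableEq D] (G : CombMap D)
    (h : G.HasEdgeInsideCycle) : ¬ G.IsDiminimalTPM := by
  intro hG
  obtain ⟨c, R, ⟨hc, -, ⟨x₀, -, rfl⟩, hsc⟩, x, hx, hxR, hxc⟩ := h
  have hP := hG.isTPM.polyhedral
  -- both ends of an edge of the cycle are initial vertices of darts of the cycle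
  have hends : ∀ a, G.edge a ∈ c.map G.edge → ∃ y ∈ c, G.vertex y = G.vertex a := by
    intro a ha
    obtain ⟨y, hy, hya⟩ := List.mem_map.1 ha
    rcases G.edge_eq_iff.1 hya with rfl | rfl
    · exact ⟨a, hy, rfl⟩
    · have h1 : G.vertex (G.α y) ∈ (c.map G.vertex).rotate 1 := by
        rw [← hc.closed]; exact List.mem_map.2 ⟨y, hy, rfl⟩
      rw [List.mem_rotate] at h1
      obtain ⟨z, hz, hz'⟩ := List.mem_map.1 h1
      exact ⟨z, hz, hz'⟩
  have hRφ : ∀ y ∈ G.side c x₀, G.φ y ∈ G.side c x₀ := fun y hy => hy.tail (Or.inl rfl)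
  have hRα : ∀ y ∈ G.side c x₀, (∀ z ∈ c, G.vertex z ≠ G.vertex y) → G.α y ∈ G.side c x₀ :=
    fun y hy hyc => hy.tail (Or.inr ⟨rfl, fun hh => by
      obtain ⟨z, hz, hz'⟩ := hends y hh
      exact hyc z hz hz'⟩)
  -- the region contains all faces at a vertex that is not on the cycle
  have hRσ : ∀ y z, G.σ.SameCycle y z → y ∈ G.side c x₀ →
      (∀ z ∈ c, G.vertex z ≠ G.vertex y) → z ∈ G.side c x₀ := by
    intro y z hyz hy hyc
    refine sameCycle_induction (G.σ.sameCycle_inv.2 hyz) hy fun t ht htR => ?_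
    have h1 := hRφ _ (hRα t htR fun z hz => by
      rw [← G.vertex_eq_iff.2 (Perm.sameCycle_inv.1 ht)]; exact hyc z hz)
    rwa [G.φ_α] at h1
  have hαR : G.α x ∈ G.side c x₀ := hRα x hxR fun z hz => (hxc z hz).1
  by_cases hb : G.Blocked x
  · by_cases hb' : G.dual.Blocked x
    · exact CombMap.not_blocked_of_region hx hRφ
        (fun y hy => hRσ x y hy hxR fun z hz => (hxc z hz).1)
        (fun y hy => hRσ _ y hy hαR fun z hz => (hxc z hz).2)
        (fun Γ hΓ => hsc.trivial x hxR Γ hΓ) hb hb'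
    · exact hG.not_shrinkable x hx (hP.shrinkable hx hb')
  · exact hG.not_removable x hx (hP.removable hx hb)
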